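/- Let $m,n$ be integers with $1\le m<n$. For an integer matrix $A=(B\,|\,N)\in\mathbb Z^{m\times n}$ with $B\in\mathbb Z^{m\times m}$ nonsingular and $N\in\mathbb Z^{m\times(n-m)}$, let $l_N$ be the Euclidean length of the longest column of $N$, let $\gcd(A)$ be the greatest common divisor of all $m\times m$ subdeterminants of $A$, let $\mathcal C_B\subset\mathbb R^m$ be the cone of all nonnegative real combinations of the columns of $B$, and, for $t\ge 0$, let $\mathcal C_B(t)$ be the set of points of $\mathcal C_B$ whose Euclidean distance from the boundary of $\mathcal C_B$ is at least $t$. There is a single algorithm, whose running time (number of bit operations) is bounded by a polynomial in the binary encoding length of the input, which, given any input $(A,b)$ with $A=(B\,|\,N)\in\mathbb Z^{m\times n}$, $1\le m<n$, $B$ nonsingular, and $$b\in\mathbb Z^m\cap\mathcal C_B\!\left(l_N\left(\frac{|\det B|}{\gcd(A)}-1\right)\right),$$ finds a nonnegative integer solution $x\in\mathbb Z^n$ of $Ax=b$ or determines that no such solution exists. -/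

import Mathlib

/-! ### A random access machine with bit cost

Programs are finite structured programs over integer variables `0, 1, 2, …` and integer arrays
`0, 1, 2, …` with integer addresses.  Every access and every arithmetic operation is charged by
the binary lengths of all the numbers involved (addresses included), so that, as for every
logarithmic-cost random access machine, polynomial cost is the same as polynomial time on a
Turing machine. -/

namespace BitRAM

/-- The memory: variable `v` holds `var v`, and cell `i` of array `a` holds `arr a i`. -/
structure Mem where
  var : ℕ → ℤ
  arr : ℕ → ℤ → ℤ

/-- The number of binary digits of `|z|`. -/
def bits (z : ℤ) : ℕ := Nat.size z.natAbs

/-- The arithmetic operations. -/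
inductive Op
  | add
  | sub
  | mul
  | div

/-- The value of an operation; `div` rounds to an integer, with remainder in `[0, |y|)`,
and division by zero gives zero. -/
def Op.eval : Op → ℤ → ℤ → ℤ
  | .add, x, y => x + y
  | .sub, x, y => x - y
  | .mul, x, y => x * y
  | .div, x, y => x / y

/-- Integer expressions. -/
inductive Expr
  | const (c : ℤ)
  | var (v : ℕ)
  | read (a : ℕ) (i : Expr)
  | op (o : Op) (e f : Expr)

/-- The value of an expression. -/
def Expr.eval (s : Mem) : Expr → ℤ
  | .const c => c
  | .var v => s.var v
  | .read a i => s.arr a (i.eval s)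
  | .op o e f => o.eval (e.eval s) (f.eval s)

/-- The cost of evaluating an expression.  Every operation on `x` and `y` is charged
`(bits x + 1) * (bits y + 1)`, the schoolbook bound for multiplication and division. -/
def Expr.cost (s : Mem) : Expr → ℕ
  | .const c => bits c + 1
  | .var v => bits (s.var v) + 1
  | .read a i => i.cost s + bits (i.eval s) + bits (s.arr a (i.eval s)) + 1
  | .op _ e f => e.cost s + f.cost s + (bits (e.eval s) + 1) * (bits (f.eval s) + 1)

/-- Programs. -/
inductive Prog
  | nop
  /-- variable `v` becomes the value of `e` -/
  | assign (v : ℕ) (e : Expr)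
  /-- cell `i` of array `a` becomes the value of `e` -/
  | write (a : ℕ) (i e : Expr)
  | seq (p q : Prog)
  /-- run `p` if `e` is positive, and `q` otherwise -/
  | cond (e : Expr) (p q : Prog)
  /-- run `p` again and again as long as `e` is positive -/
  | loop (e : Expr) (p : Prog)

/-- The memory after `assign v e`. -/
def Mem.assign (s : Mem) (v : ℕ) (z : ℤ) : Mem :=
  { s with var := Function.update s.var v z }

/-- The memory after writing `z` to cell `i` of array `a`. -/
def Mem.write (s : Mem) (a : ℕ) (i z : ℤ) : Mem :=
  { s with arr := Function.update s.arr a (Function.update (s.arr a) i z) }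

/-- `Run p s s' t`: the program `p`, started with memory `s`, halts with memory `s'`, at total
cost `t`. -/
inductive Run : Prog → Mem → Mem → ℕ → Prop
  | nop (s : Mem) : Run .nop s s 1
  | assign (s : Mem) (v : ℕ) (e : Expr) :
      Run (.assign v e) s (s.assign v (e.eval s)) (e.cost s + bits (e.eval s) + 1)
  | write (s : Mem) (a : ℕ) (i e : Expr) :
      Run (.write a i e) s (s.write a (i.eval s) (e.eval s))
        (i.cost s + e.cost s + bits (i.eval s) + bits (e.eval s) + 1)
  | seq {p q : Prog} {s s' s'' : Mem} {t t' : ℕ} (hp : Run p s s' t) (hq : Run q s' s'' t') :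
      Run (.seq p q) s s'' (t + t' + 1)
  | cond_pos {e : Expr} {p q : Prog} {s s' : Mem} {t : ℕ} (h : 0 < e.eval s)
      (hp : Run p s s' t) : Run (.cond e p q) s s' (e.cost s + t + 1)
  | cond_neg {e : Expr} {p q : Prog} {s s' : Mem} {t : ℕ} (h : ¬ 0 < e.eval s)
      (hq : Run q s s' t) : Run (.cond e p q) s s' (e.cost s + t + 1)
  | loop_stop {e : Expr} {p : Prog} {s : Mem} (h : ¬ 0 < e.eval s) :
      Run (.loop e p) s s (e.cost s + 1)
  | loop_step {e : Expr} {p : Prog} {s s' s'' : Mem} {t t' : ℕ} (h : 0 < e.eval s)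
      (hp : Run p s s' t) (hl : Run (.loop e p) s' s'' t') :
      Run (.loop e p) s s'' (e.cost s + t + t' + 1)

/-- Runs are deterministic: the final memory and the cost are functions of the program and the
initial memory. -/
theorem Run.deterministic {p : Prog} {s s₁ s₂ : Mem} {t₁ t₂ : ℕ}
    (h₁ : Run p s s₁ t₁) (h₂ : Run p s s₂ t₂) : s₁ = s₂ ∧ t₁ = t₂ := by
  induction h₁ generalizing s₂ t₂ with
  | nop | assign | write => cases h₂; exact ⟨rfl, rfl⟩
  | seq _ _ ihp ihq =>
    cases h₂ with
    | seq hp hq =>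
      obtain ⟨rfl, rfl⟩ := ihp hp
      obtain ⟨rfl, rfl⟩ := ihq hq
      exact ⟨rfl, rfl⟩
  | cond_pos h _ ih =>
    cases h₂ with
    | cond_pos _ hp => obtain ⟨rfl, rfl⟩ := ih hp; exact ⟨rfl, rfl⟩
    | cond_neg h' _ => exact absurd h h'
  | cond_neg h _ ih =>
    cases h₂ with
    | cond_pos h' _ => exact absurd h' h
    | cond_neg _ hq => obtain ⟨rfl, rfl⟩ := ih hq; exact ⟨rfl, rfl⟩
  | loop_stop h =>
    cases h₂ with
    | loop_stop => exact ⟨rfl, rfl⟩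
    | loop_step h' => exact absurd h' h
  | loop_step h _ _ ihp ihl =>
    cases h₂ with
    | loop_stop h' => exact absurd h h'
    | loop_step _ hp hl =>
      obtain ⟨rfl, rfl⟩ := ihp hp
      obtain ⟨rfl, rfl⟩ := ihl hl
      exact ⟨rfl, rfl⟩

/-- The initial memory on input `l`: the entries of `l` are in cells `0, 1, 2, …` of array `0`,
and everything else is zero. -/
def Mem.ofInput (l : List ℤ) : Mem where
  var _ := 0
  arr a i := if a = 0 ∧ 0 ≤ i then l.getD i.toNat 0 else 0

/-- The output in a final memory: variable `0` holds its length, and its entries are in cells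
`0, 1, 2, …` of array `1`. -/
def Mem.output (s : Mem) : List ℤ :=
  List.ofFn fun i : Fin (s.var 0).toNat => s.arr 1 (i.val : ℤ)

/-- `p` halts on input `l` with output `o`, at total cost at most `t`. -/
def Prog.OutputsInTime (p : Prog) (l o : List ℤ) (t : ℕ) : Prop :=
  ∃ (s : Mem) (t' : ℕ), Run p (Mem.ofInput l) s t' ∧ t' ≤ t ∧ s.output = o

/-- The binary length of a list of integers (one extra symbol per entry for sign and
separator). -/
def inputSize (l : List ℤ) : ℕ := (l.map fun z => bits z + 1).sum

end BitRAM

/-! ### Systems `A x = b` with `A = (B | N)` -/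

/-- The columns of an integer matrix, as vectors of Euclidean space. -/
noncomputable def euclideanCol {m : ℕ} {ι : Type*} (M : Matrix (Fin m) ι ℤ) (j : ι) :
    EuclideanSpace ℝ (Fin m) :=
  WithLp.toLp 2 fun i => (M i j : ℝ)

/-- The cone generated by the columns of `M`. -/
def colCone {m : ℕ} {ι : Type*} [Fintype ι] (M : Matrix (Fin m) ι ℤ) :
    Set (EuclideanSpace ℝ (Fin m)) :=
  {y | ∃ c : ι → ℝ, (∀ j, 0 ≤ c j) ∧ y = ∑ j, c j • euclideanCol M j}

/-- The points of the cone generated by the columns of `M` whose Euclidean distance from the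
boundary of this cone is at least `t`. -/
def deepCone {m : ℕ} {ι : Type*} [Fintype ι] (M : Matrix (Fin m) ι ℤ) (t : ℝ) :
    Set (EuclideanSpace ℝ (Fin m)) :=
  {y | y ∈ colCone M ∧ ∀ z ∈ frontier (colCone M), t ≤ dist y z}

/-- The Euclidean length of the longest column of `M`. -/
noncomputable def maxColLength {m : ℕ} {ι : Type*} (M : Matrix (Fin m) ι ℤ) : ℝ :=
  ⨆ j, ‖euclideanCol M j‖

/-- The (nonnegative) greatest common divisor of all `m × m` subdeterminants of a matrix with
`m` rows. -/
noncomputable def gcdMinors {m : ℕ} {ι : Type*} [Fintype ι] [DecidableEq ι] (A : Matrix (Fin m) ι ℤ) : ℤ :=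
  Finset.univ.gcd fun f : Fin m ↪ ι => (A.submatrix id f).det

/-- The input `(A, b)`, `A = (B | N)`, as a list of integers: the numbers of rows and of columns
of `A`, then the rows of `A`, then `b`. -/
def encodeSystem {m k : ℕ} (B : Matrix (Fin m) (Fin m) ℤ) (N : Matrix (Fin m) (Fin k) ℤ)
    (b : Fin m → ℤ) : List ℤ :=
  (m : ℤ) :: ((m + k : ℕ) : ℤ) ::
    ((List.ofFn fun i => List.ofFn (B i) ++ List.ofFn (N i)).flatten ++ List.ofFn b)

/-- A solution vector as a list of integers. -/
def encodeVec {m k : ℕ} (x : Fin m ⊕ Fin k → ℤ) : List ℤ :=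
  (List.ofFn fun i => x (Sum.inl i)) ++ List.ofFn fun j => x (Sum.inr j)

/-- `o` is a correct answer to the task "find a nonnegative integer solution of `A x = b` or
determine that none exists": either `o` is `1` followed by such a solution, or there is none and
`o` is the single number `0`. -/
def IsCorrectAnswer {m k : ℕ} (A : Matrix (Fin m) (Fin m ⊕ Fin k) ℤ) (b : Fin m → ℤ)
    (o : List ℤ) : Prop :=
  (∃ x : Fin m ⊕ Fin k → ℤ, (∀ j, 0 ≤ x j) ∧ A.mulVec x = b ∧ o = 1 :: encodeVec x) ∨
    ((¬ ∃ x : Fin m ⊕ Fin k → ℤ, (∀ j, 0 ≤ x j) ∧ A.mulVec x = b) ∧ o = [0])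

namespace BitRAM

/-! ### Bit lengths -/

theorem bits_le_iff {z : ℤ} {β : ℕ} : bits z ≤ β ↔ |z| < 2 ^ β := by
  rw [bits, Nat.size_le, Int.abs_eq_natAbs]
  exact_mod_cast Iff.rfl

theorem bits_op_le (o : Op) (x y : ℤ) : bits (o.eval x y) ≤ bits x + bits y + 1 := by
  have hx : |x| < 2 ^ bits x := bits_le_iff.1 le_rfl
  have hy : |y| < 2 ^ bits y := bits_le_iff.1 le_rfl
  have h1 : (1 : ℤ) ≤ 2 ^ bits x := one_le_pow₀ (by norm_num)
  have h2 : (1 : ℤ) ≤ 2 ^ bits y := one_le_pow₀ (by norm_num)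
  rw [bits_le_iff, pow_succ, pow_add]
  cases o with
  | add => exact (abs_add_le x y).trans_lt (by nlinarith)
  | sub => exact (abs_sub x y).trans_lt (by nlinarith)
  | mul =>
    simp only [Op.eval, abs_mul]
    nlinarith [abs_nonneg x, abs_nonneg y]
  | div => exact (Int.abs_ediv_le_abs x y).trans_lt (by nlinarith)

/-! ### Expressions -/

instance : Add Expr := ⟨.op .add⟩
instance : Sub Expr := ⟨.op .sub⟩
instance : Mul Expr := ⟨.op .mul⟩
instance : Div Expr := ⟨.op .div⟩

namespace Expr

variable (s : Mem) (e f : Expr)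

@[simp] theorem eval_add : (e + f).eval s = e.eval s + f.eval s := rfl
@[simp] theorem eval_sub : (e - f).eval s = e.eval s - f.eval s := rfl
@[simp] theorem eval_mul : (e * f).eval s = e.eval s * f.eval s := rfl
@[simp] theorem eval_div : (e / f).eval s = e.eval s / f.eval s := rfl
@[simp] theorem eval_const (c : ℤ) : (const c).eval s = c := rfl
@[simp] theorem eval_var (v : ℕ) : (var v).eval s = s.var v := rfl
@[simp] theorem eval_read (a : ℕ) : (read a e).eval s = s.arr a (e.eval s) := rfl

/-- The remainder of a division. -/
def mod : Expr := e - e / f * f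

/-- One if the value of the expression is zero, and zero otherwise. -/
def isZero : Expr := const 1 / (e * e + const 1)

@[simp] theorem eval_mod : (e.mod f).eval s = e.eval s % f.eval s := by
  simp [mod, Int.emod_def, mul_comm]

@[simp] theorem eval_isZero : e.isZero.eval s = if e.eval s = 0 then 1 else 0 := by
  simp only [isZero, eval_div, eval_const, eval_add, eval_mul]
  split_ifs with h
  · simp [h]
  · apply Int.ediv_eq_zero_of_lt zero_le_one
    have := mul_self_pos.2 h
    lia

/-- A syntactic measure that controls the cost of evaluation. -/
def weight : Expr → ℕ
  | const c => bits c + 1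
  | var _ => 1
  | read _ i => weight i + 1
  | op _ e f => weight e + weight f

theorem weight_pos (e : Expr) : 0 < e.weight := by
  induction e <;> simp only [weight] <;> lia

end Expr

/-- All numbers in the memory have at most `β` binary digits. -/
def Mem.Bounded (β : ℕ) (s : Mem) : Prop :=
  (∀ v, bits (s.var v) ≤ β) ∧ ∀ a i, bits (s.arr a i) ≤ β

theorem Expr.bits_eval_lt {s : Mem} {β : ℕ} (hs : s.Bounded β) (e : Expr) :
    bits (e.eval s) + 1 ≤ e.weight * (β + 1) := by
  induction e with
  | const c => simp only [Expr.eval, weight]; nlinarith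
  | var v => simpa [weight] using hs.1 v
  | read a i ih =>
    have := hs.2 a (i.eval s)
    simp only [Expr.eval, weight]
    nlinarith
  | op o e f ihe ihf =>
    have := bits_op_le o (e.eval s) (f.eval s)
    simp only [Expr.eval, weight]
    nlinarith

theorem Expr.cost_le {s : Mem} {β : ℕ} (hs : s.Bounded β) (e : Expr) :
    e.cost s ≤ (e.weight * (β + 1)) ^ 2 := by
  induction e with
  | const c => simp only [Expr.cost, weight]; nlinarith [Nat.zero_le (bits c * β)]
  | var v => have := hs.1 v; simp only [Expr.cost, weight]; nlinarith
  | read a i ih =>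
    have h1 := hs.2 a (i.eval s)
    have h2 := i.bits_eval_lt hs
    simp only [Expr.cost, weight]
    nlinarith [Nat.zero_le (i.weight * (β + 1)), Nat.zero_le β,
      Nat.mul_le_mul_left (i.weight * (β + 1)) (Nat.le_add_left 1 β)]
  | op o e f ihe ihf =>
    have h1 := e.bits_eval_lt hs
    have h2 := f.bits_eval_lt hs
    have h3 := Nat.mul_le_mul h1 h2
    simp only [Expr.cost, weight]
    nlinarith [Nat.zero_le (e.weight * (β + 1) * (f.weight * (β + 1)))]

/-! ### Cost of programs in bounded memory -/

/-- The total weight of the expressions of a program. -/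
def Prog.weight : Prog → ℕ
  | .nop => 1
  | .assign _ e => e.weight
  | .write _ i e => i.weight + e.weight
  | .seq p q => p.weight + q.weight
  | .cond e p q => e.weight + p.weight + q.weight
  | .loop e p => e.weight + p.weight

theorem Prog.weight_pos (p : Prog) : 0 < p.weight := by
  induction p with
  | nop => exact one_pos
  | assign v e => exact e.weight_pos
  | write a i e => exact Nat.add_pos_left i.weight_pos _
  | seq p q hp hq => exact Nat.add_pos_left hp _
  | cond e p q => exact Nat.add_pos_left (Nat.add_pos_left e.weight_pos _) _
  | loop e p => exact Nat.add_pos_left e.weight_pos _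

/-- A bound for the cost of one elementary step of a program in memory with entries of at most
`β` binary digits. -/
def stepCost (w β : ℕ) : ℕ := 4 * (w * (β + 1)) ^ 2

theorem stepCost_mono {w w' : ℕ} (h : w ≤ w') (β : ℕ) : stepCost w β ≤ stepCost w' β := by
  unfold stepCost; gcongr

/-- Started with the memory `s` (with entries of at most `β` binary digits), the program `p`
halts after at most `n` elementary steps, all the time with entries of at most `β` binary digits,
and the final memory satisfies `Q`. -/
def Prog.Does (p : Prog) (β : ℕ) (s : Mem) (n : ℕ) (Q : Mem → Prop) : Prop :=
  s.Bounded β → ∃ s' t, Run p s s' t ∧ s'.Bounded β ∧ t ≤ n * stepCost p.weight β ∧ Q s'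

theorem Prog.Does.mono {p : Prog} {β : ℕ} {s : Mem} {n n' : ℕ} {Q Q' : Mem → Prop}
    (h : p.Does β s n Q) (hn : n ≤ n') (hQ : ∀ s', s'.Bounded β → Q s' → Q' s') :
    p.Does β s n' Q' := fun hs => by
  obtain ⟨s', t, hr, hb, ht, hq⟩ := h hs
  exact ⟨s', t, hr, hb, ht.trans (Nat.mul_le_mul_right _ hn), hQ s' hb hq⟩

theorem Prog.Does.imp {p : Prog} {β : ℕ} {s : Mem} {n : ℕ} {Q Q' : Mem → Prop}
    (h : p.Does β s n Q) (hQ : ∀ s', Q s' → Q' s') : p.Does β s n Q' :=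
  h.mono le_rfl fun s' _ => hQ s'

theorem cost_add_one_le {s : Mem} {β w : ℕ} (hs : s.Bounded β) (e : Expr) (h : e.weight ≤ w) :
    e.cost s + 1 ≤ stepCost w β := by
  refine le_trans ?_ (stepCost_mono h β)
  have h1 := e.cost_le hs
  have h2 : 1 ≤ (e.weight * (β + 1)) ^ 2 :=
    Nat.one_le_pow _ _ (Nat.mul_pos e.weight_pos β.succ_pos)
  unfold stepCost
  lia

theorem one_le_stepCost {w : ℕ} (hw : 0 < w) (β : ℕ) : 1 ≤ stepCost w β := by
  have : 1 ≤ (w * (β + 1)) ^ 2 := Nat.one_le_pow _ _ (Nat.mul_pos hw β.succ_pos)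
  unfold stepCost
  lia

theorem Mem.Bounded.assign {s : Mem} {β : ℕ} (hs : s.Bounded β) (v : ℕ) {z : ℤ}
    (hz : bits z ≤ β) : (s.assign v z).Bounded β := by
  refine ⟨fun u => ?_, hs.2⟩
  by_cases h : u = v
  · subst h; simpa [Mem.assign] using hz
  · simpa [Mem.assign, h] using hs.1 u

theorem Mem.Bounded.write {s : Mem} {β : ℕ} (hs : s.Bounded β) (a : ℕ) (i : ℤ) {z : ℤ}
    (hz : bits z ≤ β) : (s.write a i z).Bounded β := by
  refine ⟨hs.1, fun b j => ?_⟩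
  by_cases h : b = a
  · subst h
    by_cases h' : j = i
    · subst h'; simpa [Mem.write] using hz
    · simpa [Mem.write, h'] using hs.2 b j
  · simpa [Mem.write, h] using hs.2 b j

@[simp] theorem Mem.assign_var (s : Mem) (v : ℕ) (z : ℤ) (u : ℕ) :
    (s.assign v z).var u = if u = v then z else s.var u := by
  simp [Mem.assign, Function.update_apply]

@[simp] theorem Mem.assign_arr (s : Mem) (v : ℕ) (z : ℤ) : (s.assign v z).arr = s.arr := rfl

@[simp] theorem Mem.write_var (s : Mem) (a : ℕ) (i z : ℤ) : (s.write a i z).var = s.var := rfl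

theorem Mem.write_arr (s : Mem) (a : ℕ) (i z : ℤ) (b : ℕ) (j : ℤ) :
    (s.write a i z).arr b j = if b = a ∧ j = i then z else s.arr b j := by
  by_cases h : b = a
  · subst h; simp [Mem.write, Function.update_apply]
  · simp [Mem.write, h]

theorem Prog.does_assign {β : ℕ} {s : Mem} {v : ℕ} {e : Expr} {Q : Mem → Prop}
    (hb : bits (e.eval s) ≤ β) (hQ : Q (s.assign v (e.eval s))) :
    (Prog.assign v e).Does β s 1 Q := fun hs => by
  refine ⟨_, _, Run.assign s v e, hs.assign v hb, ?_, hQ⟩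
  have h1 := e.cost_le hs
  have h2 := e.bits_eval_lt hs
  have h3 : e.weight * (β + 1) ≤ (e.weight * (β + 1)) ^ 2 := Nat.le_self_pow two_ne_zero _
  simp only [stepCost, Prog.weight]
  lia

theorem Prog.does_write {β : ℕ} {s : Mem} {a : ℕ} {i e : Expr} {Q : Mem → Prop}
    (hb : bits (e.eval s) ≤ β) (hQ : Q (s.write a (i.eval s) (e.eval s))) :
    (Prog.write a i e).Does β s 1 Q := fun hs => by
  refine ⟨_, _, Run.write s a i e, hs.write a _ hb, ?_, hQ⟩
  have h1 := e.cost_le hs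
  have h2 := e.bits_eval_lt hs
  have h3 := i.cost_le hs
  have h4 := i.bits_eval_lt hs
  simp only [stepCost, Prog.weight]
  nlinarith [Nat.le_self_pow two_ne_zero (e.weight * (β + 1)),
    Nat.le_self_pow two_ne_zero (i.weight * (β + 1)),
    Nat.zero_le (e.weight * (β + 1) * (i.weight * (β + 1)))]

theorem Prog.Does.seq {p q : Prog} {β : ℕ} {s : Mem} {n n' : ℕ} {Q R : Mem → Prop}
    (hp : p.Does β s n Q) (hq : ∀ s', Q s' → q.Does β s' n' R) :
    (Prog.seq p q).Does β s (n + n' + 1) R := fun hs => by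
  obtain ⟨s', t, hr, hb, ht, h⟩ := hp hs
  obtain ⟨s'', t', hr', hb', ht', h'⟩ := hq s' h hb
  refine ⟨s'', _, hr.seq hr', hb', ?_, h'⟩
  have h1 := Nat.mul_le_mul_left n (stepCost_mono (Nat.le_add_right p.weight q.weight) β)
  have h2 := Nat.mul_le_mul_left n' (stepCost_mono (Nat.le_add_left q.weight p.weight) β)
  have h3 := one_le_stepCost (Nat.add_pos_left p.weight_pos q.weight) β
  simp only [Prog.weight, add_mul, one_mul]
  lia

theorem Prog.does_cond {e : Expr} {p q : Prog} {β : ℕ} {s : Mem} {n : ℕ} {Q : Mem → Prop}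
    (hp : 0 < e.eval s → p.Does β s n Q) (hq : ¬ 0 < e.eval s → q.Does β s n Q) :
    (Prog.cond e p q).Does β s (n + 1) Q := fun hs => by
  have hc := cost_add_one_le (w := (Prog.cond e p q).weight) hs e (by simp only [weight]; lia)
  by_cases h : 0 < e.eval s
  · obtain ⟨s', t, hr, hb, ht, h'⟩ := hp h hs
    refine ⟨s', _, Run.cond_pos h hr, hb, ?_, h'⟩
    have h1 := Nat.mul_le_mul_left n (stepCost_mono (w := p.weight)
      (w' := (Prog.cond e p q).weight) (by simp only [weight]; lia) β)
    rw [add_mul, one_mul]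
    lia
  · obtain ⟨s', t, hr, hb, ht, h'⟩ := hq h hs
    refine ⟨s', _, Run.cond_neg h hr, hb, ?_, h'⟩
    have h1 := Nat.mul_le_mul_left n (stepCost_mono (w := q.weight)
      (w' := (Prog.cond e p q).weight) (by simp only [weight]; lia) β)
    rw [add_mul, one_mul]
    lia

/-- A loop whose body makes the measure `F` decrease. -/
theorem Prog.does_loop {e : Expr} {p : Prog} {β : ℕ} {n : ℕ} (I : ℕ → Mem → Prop)
    (hdone : ∀ s, I 0 s → ¬ 0 < e.eval s)
    (hstep : ∀ N s, s.Bounded β → I (N + 1) s → 0 < e.eval s →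
      p.Does β s n (fun s' => ∃ N' ≤ N, I N' s'))
    {N : ℕ} {s : Mem} (h : I N s) :
    (Prog.loop e p).Does β s (N * (n + 1) + 1) (fun s' => (∃ N', I N' s') ∧ ¬ 0 < e.eval s') := by
  intro hs
  have hw : e.weight ≤ (Prog.loop e p).weight := by simp only [weight]; lia
  induction N using Nat.strong_induction_on generalizing s with
  | _ N ih =>
    have hc := cost_add_one_le hs e hw
    by_cases he : 0 < e.eval s
    · cases N with
      | zero => exact absurd he (hdone s h)
      | succ N =>
        obtain ⟨s', t, hr, hb, ht, N', hN', h'⟩ := hstep N s hs h he hs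
        obtain ⟨s'', t', hr', hb', ht', h''⟩ := ih N' (by lia) h' hb
        refine ⟨s'', _, Run.loop_step he hr hr', hb', ?_, h''⟩
        have h1 := Nat.mul_le_mul_left n (stepCost_mono (w := p.weight)
          (w' := (Prog.loop e p).weight) (by simp only [weight]; lia) β)
        have h2 := Nat.mul_le_mul_right (stepCost (Prog.loop e p).weight β)
          (Nat.add_le_add_right (Nat.mul_le_mul_right (n + 1) hN') 1)
        have h3 : ((N + 1) * (n + 1) + 1) * stepCost (Prog.loop e p).weight β =
          (N * (n + 1) + 1) * stepCost (Prog.loop e p).weight β +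
          n * stepCost (Prog.loop e p).weight β + stepCost (Prog.loop e p).weight β := by ring
        lia
    · refine ⟨s, _, Run.loop_stop he, hs, ?_, ⟨N, h⟩, he⟩
      exact hc.trans (Nat.le_mul_of_pos_left _ (by lia))

/-! ### Counting loops -/

/-- Run `p` with `v = 0, 1, …, e - 1`. -/
def forLoop (v : ℕ) (e : Expr) (p : Prog) : Prog :=
  .seq (.assign v (.const 0))
    (.loop (e - .var v) (.seq p (.assign v (.var v + .const 1))))

theorem does_forLoop {v : ℕ} {e : Expr} {p : Prog} {β : ℕ} {s : Mem} {n N : ℕ}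
    (I : ℕ → Mem → Prop) (hN : bits N ≤ β)
    (h0 : I 0 (s.assign v 0))
    (he : ∀ j ≤ N, ∀ s, I j s → s.var v = j → e.eval s = N)
    (hstep : ∀ j < N, ∀ s, s.Bounded β → I j s → s.var v = j →
      p.Does β s n (fun s' => s'.var v = j ∧ I (j + 1) (s'.assign v (j + 1)))) :
    (forLoop v e p).Does β s (N * (n + 3) + 3) (I N) := by
  have hbits : ∀ j ≤ N, bits j ≤ β := fun j hj => by
    rw [bits_le_iff] at hN ⊢
    rw [abs_of_nonneg (by positivity)] at hN ⊢
    exact lt_of_le_of_lt (by exact_mod_cast hj) hN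
  refine (Prog.Does.seq (n := 1) (n' := N * (n + 3) + 1)
    (Prog.does_assign (Q := fun s' => I 0 s' ∧ s'.var v = (0 : ℕ)) (hbits 0 (Nat.zero_le _))
      ⟨h0, by simp⟩) ?_).mono (by lia) fun s' _ h => h
  rintro s' ⟨h0', hv⟩
  refine (Prog.does_loop (n := n + 2)
    (fun r s => ∃ j, j + r = N ∧ I j s ∧ s.var v = j) ?_ ?_ (N := N)
    ⟨0, by simp, h0', hv⟩).mono (by lia) ?_
  · rintro s ⟨j, hj, hI, hvj⟩
    obtain rfl : j = N := by lia
    simp [he j le_rfl s hI hvj, hvj]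
  · rintro r s hs ⟨j, hj, hI, hvj⟩ -
    refine ((hstep j (by lia) s hs hI hvj).seq fun s' h => Prog.does_assign (v := v)
      (e := .var v + .const 1)
      (Q := fun s' => I (j + 1) s' ∧ s'.var v = (j + 1 : ℕ)) ?_ ?_).mono (by lia) ?_
    · simpa [h.1] using hbits (j + 1) (by lia)
    · simpa [h.1] using h.2
    · rintro s' - ⟨h1, h2⟩
      exact ⟨r, le_rfl, j + 1, by lia, h1, h2⟩
  · rintro s' - ⟨⟨r, j, hj, hI, hvj⟩, hpos⟩
    have := he j (by lia) s' hI hvj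
    simp only [Expr.eval_sub, Expr.eval_var, this, hvj] at hpos
    obtain rfl : j = N := by lia
    exact hI

/-! ### Sums and tables -/

/-- The memories agree outside the variables `vs` and the arrays `as`. -/
def Mem.EqOff (vs as : List ℕ) (s s' : Mem) : Prop :=
  (∀ v, v ∉ vs → s'.var v = s.var v) ∧ ∀ a, a ∉ as → s'.arr a = s.arr a

theorem Mem.EqOff.refl (vs as : List ℕ) (s : Mem) : s.EqOff vs as s :=
  ⟨fun _ _ => rfl, fun _ _ => rfl⟩

theorem Mem.EqOff.trans {vs vs' as as' : List ℕ} {s s' s'' : Mem} (h : s.EqOff vs as s')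
    (h' : s'.EqOff vs' as' s'') : s.EqOff (vs ++ vs') (as ++ as') s'' :=
  ⟨fun v hv => by simp at hv; rw [h'.1 v hv.2, h.1 v hv.1],
    fun a ha => by simp at ha; rw [h'.2 a ha.2, h.2 a ha.1]⟩

theorem Mem.EqOff.mono {vs vs' as as' : List ℕ} {s s' : Mem} (h : s.EqOff vs as s')
    (hv : vs ⊆ vs') (ha : as ⊆ as') : s.EqOff vs' as' s' :=
  ⟨fun v h' => h.1 v fun h'' => h' (hv h''), fun a h' => h.2 a fun h'' => h' (ha h'')⟩

theorem Mem.EqOff.assign {vs as : List ℕ} {s s' : Mem} (h : s.EqOff vs as s') {v : ℕ}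
    (hv : v ∈ vs) (z : ℤ) : s.EqOff vs as (s'.assign v z) :=
  ⟨fun u hu => by
    have : u ≠ v := fun h => hu (h ▸ hv)
    simp [this, h.1 u hu], h.2⟩

theorem Mem.EqOff.write {vs as : List ℕ} {s s' : Mem} (h : s.EqOff vs as s') {a : ℕ}
    (ha : a ∈ as) (i z : ℤ) : s.EqOff vs as (s'.write a i z) :=
  ⟨h.1, fun b hb => by
    have : b ≠ a := fun h => hb (h ▸ ha)
    ext j
    simp [Mem.write_arr, this, h.2 b hb]⟩

/-- Variable `5` becomes the sum of the values of `e` for `0, …, R - 1` in variable `4`. -/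
def sumTo (R e : Expr) : Prog :=
  .seq (.assign 5 (.const 0)) (forLoop 4 R (.assign 5 (.var 5 + e)))

theorem does_sumTo {R e : Expr} {β : ℕ} {s : Mem} (N : ℕ) (val : ℕ → ℤ) (hN : bits N ≤ β)
    (hR : ∀ s', s.EqOff [4, 5] [] s' → R.eval s' = N)
    (he : ∀ k < N, ∀ s', s.EqOff [4, 5] [] s' → s'.var 4 = k → e.eval s' = val k)
    (hb : ∀ k ≤ N, bits (∑ i ∈ Finset.range k, val i) ≤ β) :
    (sumTo R e).Does β s (N * 4 + 5)
      (fun s' => s.EqOff [4, 5] [] s' ∧ s'.var 5 = ∑ i ∈ Finset.range N, val i) := by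
  refine (Prog.Does.seq (n := 1) (n' := N * 4 + 3)
    (Prog.does_assign (Q := fun s' => s.EqOff [4, 5] [] s' ∧ s'.var 5 = 0) ?_ ?_) ?_).mono
    (by lia) fun s' _ h => h
  · simpa using hb 0 (Nat.zero_le _)
  · exact ⟨(Mem.EqOff.refl _ _ s).assign (by simp) _, by simp⟩
  · rintro s₁ ⟨h1, h2⟩
    refine (does_forLoop (n := 1) (N := N)
      (fun j s' => s.EqOff [4, 5] [] s' ∧ s'.var 5 = ∑ i ∈ Finset.range j, val i)
      hN ⟨h1.assign (by simp) _, by simp [h2]⟩ (fun j hj s' h _ => hR s' h.1) ?_)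
    intro j hj s' hs' h hv
    have : (Expr.var 5 + e).eval s' = ∑ i ∈ Finset.range (j + 1), val i := by
      rw [Expr.eval_add, Expr.eval_var, he j hj s' h.1 hv, h.2, Finset.sum_range_succ]
    refine Prog.does_assign (this ▸ hb (j + 1) hj) ?_
    rw [this]
    exact ⟨by simp [hv], (h.1.assign (by simp) _).assign (by simp) _, by simp⟩

/-- For `c = 0, …, len - 1` in variable `3`, sum up the values of `e` as in `sumTo`, and let cell
`base + c` of array `a` become the value of `f`. -/
def fill (a : ℕ) (base len R e f : Expr) : Prog :=
  forLoop 3 len (.seq (sumTo R e) (.write a (base + .var 3) f))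

/-- The memory when `fill` has written `c` cells. -/
def Filling (a : ℕ) (base : ℤ) (s : Mem) (c : ℕ) (s' : Mem) : Prop :=
  s.EqOff [3, 4, 5] [a] s' ∧ ∀ x : ℤ, (∀ y : ℕ, y < c → x ≠ base + y) → s'.arr a x = s.arr a x

theorem does_fill {a : ℕ} {base len R e f : Expr} {β : ℕ} {s : Mem} (b : ℤ) (L N : ℕ)
    (val : ℕ → ℕ → ℤ) (out : ℕ → ℤ) (hL : bits L ≤ β) (hN : bits N ≤ β)
    (hbase : ∀ s', s.EqOff [3, 4, 5] [a] s' → base.eval s' = b)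
    (hlen : ∀ s', s.EqOff [3, 4, 5] [a] s' → len.eval s' = L)
    (hR : ∀ s', s.EqOff [3, 4, 5] [a] s' → R.eval s' = N)
    (he : ∀ c < L, ∀ k < N, ∀ s', Filling a b s c s' → s'.var 3 = c → s'.var 4 = k →
      e.eval s' = val c k)
    (hb : ∀ c < L, ∀ k ≤ N, bits (∑ i ∈ Finset.range k, val c i) ≤ β)
    (hf : ∀ c < L, ∀ s', Filling a b s c s' → s'.var 3 = c →
      s'.var 5 = ∑ i ∈ Finset.range N, val c i → f.eval s' = out c)
    (hout : ∀ c < L, bits (out c) ≤ β) :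
    (fill a base len R e f).Does β s (L * (N * 4 + 10) + 3)
      (fun s' => Filling a b s L s' ∧ ∀ c < L, s'.arr a (b + c) = out c) := by
  refine (does_forLoop (n := N * 4 + 7) (N := L)
    (fun j s' => Filling a b s j s' ∧ ∀ c < j, s'.arr a (b + c) = out c) hL ?_
    (fun j _ s' h _ => hlen s' h.1.1) ?_).mono (by lia) fun s' _ h => h
  · exact ⟨⟨(Mem.EqOff.refl _ _ s).assign (by simp) _, fun x _ => rfl⟩, by simp⟩
  · rintro c hc s' - ⟨⟨h1, h2⟩, h3⟩ hv
    have key : ∀ s'', s'.EqOff [4, 5] [] s'' → Filling a b s c s'' ∧ s''.var 3 = c := by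
      intro s'' h
      refine ⟨⟨(h1.trans h).mono (by simp) (by simp), ?_⟩, ?_⟩
      · rw [h.2 a (by simp)]; exact h2
      · rw [h.1 3 (by simp), hv]
    refine (Prog.Does.seq (does_sumTo N (val c) hN (fun s'' h => hR s'' (key s'' h).1.1)
      (fun k hk s'' h h4 => he c hc k hk s'' (key s'' h).1 (key s'' h).2 h4) (hb c hc))
      (n' := 1) ?_).mono (by lia) fun s' _ h => h
    rintro s'' ⟨h, h5⟩
    obtain ⟨⟨k1, k2⟩, k3⟩ := key s'' h
    have hfe := hf c hc s'' ⟨k1, k2⟩ k3 h5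
    refine Prog.does_write (hfe ▸ hout c hc) ?_
    have hbe : (base + .var 3).eval s'' = b + c := by
      rw [Expr.eval_add, Expr.eval_var, k3, hbase s'' k1]
    rw [hfe, hbe]
    refine ⟨by simp [k3], ⟨(k1.write (by simp) _ _).assign (by simp) _, ?_⟩, ?_⟩
    · intro x hx
      have hxc := hx c (by lia)
      simp only [Mem.assign_arr, Mem.write_arr, hxc, and_false, if_false]
      exact k2 x fun y hy => hx y (by lia)
    · intro c' hc'
      simp only [Mem.assign_arr, Mem.write_arr]
      by_cases hcc : c' = c
      · simp [hcc]
      · have hne : (c' : ℤ) ≠ c := by exact_mod_cast hcc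
        simp only [add_right_inj, hne, and_false, if_false]
        rw [h.2 a (by simp)]
        exact h3 c' (by lia)

/-- Like `fill`, without the sum. -/
def fillMap (a : ℕ) (base len f : Expr) : Prog :=
  fill a base len (.const 0) (.const 0) f

end BitRAM

/-! ### The Faddeev–LeVerrier recursion -/

namespace Matrix

open Polynomial

section

variable {n R : Type*} [Fintype n] [DecidableEq n] [CommRing R]

theorem derivative_det (M : Matrix n n R[X]) :
    derivative M.det = ∑ i, (M.updateRow i fun j => derivative (M i j)).det := by
  have h : ∀ N : Matrix n n R[X], N.det = ∑ σ : Equiv.Perm n, Equiv.Perm.sign σ • ∏ i, N i (σ i) :=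
    fun N => by rw [← det_transpose, det_apply]; rfl
  rw [h, Polynomial.derivative_sum, Finset.sum_congr rfl fun i _ => h _, Finset.sum_comm]
  refine Finset.sum_congr rfl fun σ _ => ?_
  rw [Polynomial.derivative_smul, derivative_prod_finset, Finset.smul_sum]
  refine Finset.sum_congr rfl fun i _ => ?_
  rw [← Finset.prod_erase_mul _ _ (Finset.mem_univ i), updateRow_self]
  congr 2
  refine Finset.prod_congr rfl fun j hj => ?_
  rw [updateRow_ne (Finset.ne_of_mem_erase hj)]

theorem derivative_charpoly (A : Matrix n n R) :
    derivative A.charpoly = A.charmatrix.adjugate.trace := by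
  rw [charpoly, derivative_det, trace]
  refine Finset.sum_congr rfl fun i _ => ?_
  rw [diag_apply, adjugate_apply]
  congr 2
  ext1 j
  by_cases h : i = j
  · subst h; simp
  · simp [charmatrix_apply_ne _ _ _ h, Pi.single_eq_of_ne' h]

/-- The coefficients of the adjugate of the characteristic matrix. -/
noncomputable def adjCoeff (A : Matrix n n R) (i : ℕ) : Matrix n n R :=
  A.charmatrix.adjugate.map fun p => p.coeff i

theorem X_mul_adjugate_charmatrix (A : Matrix n n R) (a b : n) :
    X * A.charmatrix.adjugate a b =
      ∑ x, C (A a x) * A.charmatrix.adjugate x b + A.charpoly * (1 : Matrix n n R[X]) a b := by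
  have h := congrFun (congrFun (mul_adjugate A.charmatrix) a) b
  generalize A.charmatrix.adjugate = Q at *
  rw [charmatrix, sub_mul, sub_apply, scalar_apply, diagonal_mul, sub_eq_iff_eq_add'] at h
  rw [h, mul_apply]
  rfl

theorem adjCoeff_mul (A : Matrix n n R) (i : ℕ) :
    A.adjCoeff i = A * A.adjCoeff (i + 1) + A.charpoly.coeff (i + 1) • 1 := by
  ext a b
  have h := congrArg (fun p => p.coeff (i + 1)) (A.X_mul_adjugate_charmatrix a b)
  simp only [coeff_X_mul, coeff_add, finsetSum_coeff, coeff_C_mul] at h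
  simp only [add_apply, mul_apply, smul_apply, adjCoeff, map_apply, smul_eq_mul, h, one_apply]
  split_ifs <;> simp

theorem mul_adjCoeff_zero (A : Matrix n n R) :
    A * A.adjCoeff 0 = -A.charpoly.coeff 0 • 1 := by
  ext a b
  have h := congrArg (fun p => p.coeff 0) (A.X_mul_adjugate_charmatrix a b)
  simp only [coeff_X_mul_zero, coeff_add, finsetSum_coeff, coeff_C_mul] at h
  simp only [mul_apply, smul_apply, adjCoeff, map_apply, smul_eq_mul, one_apply] at h ⊢
  rw [eq_neg_of_add_eq_zero_left h.symm]
  split_ifs <;> simp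

theorem trace_adjCoeff (A : Matrix n n R) (i : ℕ) :
    (A.adjCoeff i).trace = A.charpoly.coeff (i + 1) * (i + 1) := by
  rw [← coeff_derivative, derivative_charpoly]
  simp [trace, adjCoeff]

theorem adjCoeff_eq_zero [Nontrivial R] (A : Matrix n n R) {i : ℕ} (hi : Fintype.card n ≤ i) :
    A.adjCoeff i = 0 := by
  obtain ⟨N, hN⟩ : ∃ N, ∀ j, N ≤ j → A.adjCoeff j = 0 := by
    refine ⟨(∑ a, ∑ b, (A.charmatrix.adjugate a b).natDegree) + 1, fun j hj => ?_⟩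
    ext a b
    refine coeff_eq_zero_of_natDegree_lt (lt_of_lt_of_le (Nat.lt_succ_of_le ?_) hj)
    refine le_trans ?_ (Finset.single_le_sum (f := fun a => ∑ b,
      (A.charmatrix.adjugate a b).natDegree) (fun _ _ => Nat.zero_le _) (Finset.mem_univ a))
    exact Finset.single_le_sum (f := fun b => (A.charmatrix.adjugate a b).natDegree)
      (fun _ _ => Nat.zero_le _) (Finset.mem_univ b)
  have key : ∀ k i, Fintype.card n ≤ i → N ≤ i + k → A.adjCoeff i = 0 := by
    intro k
    induction k with
    | zero => exact fun i _ h => hN i h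
    | succ k ih =>
      intro i hi h
      rw [adjCoeff_mul, ih (i + 1) (by lia) (by lia), coeff_eq_zero_of_natDegree_lt]
      · simp
      · rw [charpoly_natDegree_eq_dim]; lia
  exact key N i hi (by lia)

end

section

variable {m : ℕ} (B : Matrix (Fin m) (Fin m) ℤ)

/-- The matrices of the Faddeev–LeVerrier recursion. -/
noncomputable def flMat (t : ℕ) : Matrix (Fin m) (Fin m) ℤ := B.adjCoeff (m - t)

/-- The coefficients of the Faddeev–LeVerrier recursion. -/
noncomputable def flCoeff (t : ℕ) : ℤ := B.charpoly.coeff (m - t)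

theorem flMat_zero : B.flMat 0 = 0 := B.adjCoeff_eq_zero (by simp)

theorem flCoeff_zero : B.flCoeff 0 = 1 := by
  have := B.charpoly_monic.coeff_natDegree
  rwa [charpoly_natDegree_eq_dim, Fintype.card_fin] at this

theorem flMat_succ {t : ℕ} (ht : t < m) :
    B.flMat (t + 1) = B * B.flMat t + B.flCoeff t • 1 := by
  have := B.adjCoeff_mul (m - (t + 1))
  rwa [show m - (t + 1) + 1 = m - t by lia] at this

theorem mul_flMat : B * B.flMat m = -B.flCoeff m • 1 := by
  simpa [flMat, flCoeff] using B.mul_adjCoeff_zero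

theorem flCoeff_ne_zero (hB : B.det ≠ 0) : B.flCoeff m ≠ 0 := by
  intro h
  apply hB
  rw [det_eq_sign_charpoly_coeff]
  simp only [flCoeff, Nat.sub_self] at h
  simp [h]

theorem flCoeff_succ_mul {t : ℕ} (ht : t < m) :
    B.flCoeff (t + 1) * (t + 1 : ℕ) = -(B * B.flMat (t + 1)).trace := by
  rcases Nat.eq_or_lt_of_le (Nat.succ_le_of_lt ht) with h | h
  · rw [Nat.succ_eq_add_one] at h
    subst h
    rw [mul_flMat, trace_smul, trace_one, Fintype.card_fin]
    simp
  · have h1 := congrArg trace (B.adjCoeff_mul (m - (t + 1) - 1))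
    rw [trace_adjCoeff, show m - (t + 1) - 1 + 1 = m - (t + 1) by lia, trace_add, trace_smul,
      trace_one, Fintype.card_fin, smul_eq_mul] at h1
    have h2 : ((m - (t + 1) - 1 : ℕ) : ℤ) + 1 + (t + 1 : ℕ) = m := by lia
    rw [flCoeff, flMat]
    linear_combination B.charpoly.coeff (m - (t + 1)) * h2 - h1

theorem flCoeff_succ {t : ℕ} (ht : t < m) :
    B.flCoeff (t + 1) = (0 - (B * B.flMat (t + 1)).trace) / ((t : ℤ) + 1) := by
  rw [zero_sub, ← B.flCoeff_succ_mul ht, Nat.cast_succ, Int.mul_ediv_cancel _ (by lia)]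

theorem abs_mul_apply_le {p q r : ℕ} {A : Matrix (Fin p) (Fin q) ℤ} {C : Matrix (Fin q) (Fin r) ℤ}
    {x y : ℤ} (hA : ∀ a b, |A a b| ≤ x) (hC : ∀ a b, |C a b| ≤ y) (a : Fin p) (b : Fin r) :
    |(A * C) a b| ≤ q * (x * y) := by
  rw [mul_apply]
  refine (Finset.abs_sum_le_sum_abs _ _).trans ?_
  refine (Finset.sum_le_card_nsmul _ _ (x * y) fun c _ => ?_).trans (by simp)
  rw [abs_mul]
  exact mul_le_mul (hA a c) (hC c b) (abs_nonneg _) ((abs_nonneg _).trans (hA a c))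

theorem abs_fl_le (hm : 0 < m) {α : ℤ} (hα : 1 ≤ α) (hB : ∀ a b, |B a b| ≤ α) {t : ℕ}
    (ht : t ≤ m) :
    (∀ a b, |B.flMat t a b| ≤ 2 * (2 * m ^ 2 * α) ^ t) ∧
    (∀ a b, |(B * B.flMat t) a b| ≤ (2 * m ^ 2 * α) ^ t) ∧
    |B.flCoeff t| ≤ (2 * m ^ 2 * α) ^ t := by
  have hm' : (1 : ℤ) ≤ m := by exact_mod_cast hm
  have hx : 1 ≤ 2 * (m : ℤ) ^ 2 * α := by nlinarith [one_le_pow₀ hm' (n := 2)]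
  induction t with
  | zero => simp [flMat_zero, flCoeff_zero]
  | succ t ih =>
    obtain ⟨-, h1, h2⟩ := ih (by lia)
    have hy : 0 < (2 * (m : ℤ) ^ 2 * α) ^ t := by positivity
    have k1 : ∀ a b, |B.flMat (t + 1) a b| ≤ 2 * (2 * m ^ 2 * α) ^ t := by
      intro a b
      rw [flMat_succ B (by lia), add_apply, smul_apply, one_apply, smul_eq_mul]
      refine (abs_add_le _ _).trans ?_
      rw [two_mul]
      refine add_le_add (h1 a b) ?_
      split_ifs
      · simpa using h2
      · simpa using hy.le
    have k2 := abs_mul_apply_le hB k1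
    have e1 : (m : ℤ) * (m * (α * (2 * (2 * m ^ 2 * α) ^ t))) = (2 * m ^ 2 * α) ^ (t + 1) := by
      ring
    have e2 : (m : ℤ) * (α * (2 * (2 * m ^ 2 * α) ^ t)) ≤ (2 * m ^ 2 * α) ^ (t + 1) := by
      rw [← e1]
      exact le_mul_of_one_le_left (by positivity) hm'
    refine ⟨fun a b => (k1 a b).trans ?_, fun a b => (k2 a b).trans e2, ?_⟩
    · rw [pow_succ _ t]
      exact mul_le_mul_of_nonneg_left (le_mul_of_one_le_right hy.le hx) zero_le_two
    · have h3 := B.flCoeff_succ_mul (t := t) (by lia)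
      have h4 : |(B * B.flMat (t + 1)).trace| ≤ (2 * m ^ 2 * α) ^ (t + 1) := by
        rw [← e1]
        refine (Finset.abs_sum_le_sum_abs _ _).trans ?_
        exact (Finset.sum_le_card_nsmul _ _ _ fun c _ => k2 c c).trans (by simp)
      rw [← abs_neg, ← h3, abs_mul] at h4
      refine le_trans ?_ h4
      refine le_mul_of_one_le_right (abs_nonneg _) ?_
      rw [Nat.abs_cast]
      exact_mod_cast Nat.succ_pos t

end

end Matrix

/-! ### Triangular lattice bases modulo a multiple of the exponent -/

namespace Lattice

variable {n : ℕ}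

/-- The span of the rows of `T` with index at least `l`. -/
def rowSpan (T : Fin n → Fin n → ℤ) (l : ℕ) : Submodule ℤ (Fin n → ℤ) :=
  Submodule.span ℤ (T '' {a | l ≤ a.val})

theorem mem_rowSpan (T : Fin n → Fin n → ℤ) {l : ℕ} {a : Fin n} (h : l ≤ a.val) :
    T a ∈ rowSpan T l := Submodule.subset_span ⟨a, h, rfl⟩

theorem rowSpan_le {T : Fin n → Fin n → ℤ} {l : ℕ} {S : Submodule ℤ (Fin n → ℤ)}
    (h : ∀ a : Fin n, l ≤ a.val → T a ∈ S) : rowSpan T l ≤ S := by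
  rw [rowSpan, Submodule.span_le]
  rintro _ ⟨a, ha, rfl⟩
  exact h a ha

theorem rowSpan_anti (T : Fin n → Fin n → ℤ) {l l' : ℕ} (h : l ≤ l') :
    rowSpan T l' ≤ rowSpan T l := rowSpan_le fun _ ha => mem_rowSpan T (h.trans ha)

/-- The span of the rows of `T` with index at least `l`, and of `v`. -/
def rowSpanWith (T : Fin n → Fin n → ℤ) (v : Fin n → ℤ) (l : ℕ) : Submodule ℤ (Fin n → ℤ) :=
  rowSpan T l ⊔ Submodule.span ℤ {v}

theorem rowSpanWith_le {T : Fin n → Fin n → ℤ} {v : Fin n → ℤ} {l : ℕ}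
    {S : Submodule ℤ (Fin n → ℤ)} (h : ∀ a : Fin n, l ≤ a.val → T a ∈ S) (hv : v ∈ S) :
    rowSpanWith T v l ≤ S :=
  sup_le (rowSpan_le h) (by simpa [Submodule.span_le] using hv)

theorem rowSpan_le_with (T : Fin n → Fin n → ℤ) (v : Fin n → ℤ) (l : ℕ) :
    rowSpan T l ≤ rowSpanWith T v l := le_sup_left

theorem vec_mem_rowSpanWith (T : Fin n → Fin n → ℤ) (v : Fin n → ℤ) (l : ℕ) :
    v ∈ rowSpanWith T v l :=
  (le_sup_right : _ ≤ rowSpanWith T v l) (Submodule.mem_span_singleton_self v)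

/-- `S` contains the multiples of `d` of the unit vectors with index at least `l`. -/
def HasMultiples (d : ℤ) (S : Submodule ℤ (Fin n → ℤ)) (l : ℕ) : Prop :=
  ∀ b : Fin n, l ≤ b.val → Pi.single b d ∈ S

theorem HasMultiples.mem {d : ℤ} {S : Submodule ℤ (Fin n → ℤ)} {l : ℕ} (h : HasMultiples d S l)
    {w : Fin n → ℤ} (hw : ∀ b, d ∣ w b) (h0 : ∀ b : Fin n, b.val < l → w b = 0) : w ∈ S := by
  have : w = ∑ b, (w b / d) • (Pi.single b d : Fin n → ℤ) := by
    conv_lhs => rw [← Finset.univ_sum_single w]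
    refine Finset.sum_congr rfl fun b _ => ?_
    rw [← Pi.single_smul, smul_eq_mul, Int.ediv_mul_cancel (hw b)]
  rw [this]
  refine Submodule.sum_mem _ fun b _ => ?_
  by_cases hb : b.val < l
  · simp [h0 b hb]
  · exact Submodule.smul_mem _ _ (h b (by lia))

/-- An upper triangular matrix with nonzero diagonal and entries bounded by `|d|`. -/
structure IsTriangular (d : ℤ) (T : Fin n → Fin n → ℤ) : Prop where
  zero : ∀ a b, b < a → T a b = 0
  diag : ∀ a, T a a ≠ 0
  bound : ∀ a b, |T a b| ≤ |d|

/-- The rows of `T` are a triangular basis of `L`, and `d` annihilates the quotients. -/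
structure IsTriBasis (d : ℤ) (T : Fin n → Fin n → ℤ) (L : Submodule ℤ (Fin n → ℤ)) : Prop
    extends IsTriangular d T where
  span : rowSpan T 0 = L
  multiples : ∀ l, HasMultiples d (rowSpan T l) l

/-- The entries of `v` are remainders modulo `d`. -/
def IsRem (d : ℤ) (v : Fin n → ℤ) : Prop := ∀ b, 0 ≤ v b ∧ v b < |d|

theorem isRem_mod {d : ℤ} (hd : d ≠ 0) (v : Fin n → ℤ) : IsRem d fun b => v b % d :=
  fun _ => ⟨Int.emod_nonneg _ hd, Int.emod_lt_abs _ hd⟩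

/-- The state while the vector `v` is inserted: the first `i` coordinates are done. -/
structure Inserting (d : ℤ) (T : Fin n → Fin n → ℤ) (L : Submodule ℤ (Fin n → ℤ))
    (v : Fin n → ℤ) (i : ℕ) : Prop extends IsTriangular d T where
  span : rowSpanWith T v 0 = L
  multiples_le : ∀ l ≤ i, HasMultiples d (rowSpanWith T v l) l
  multiples_gt : ∀ l, i < l → HasMultiples d (rowSpan T l) l
  rem : IsRem d v
  vec_zero : ∀ b : Fin n, b.val < i → v b = 0

theorem IsTriBasis.inserting {d : ℤ} {T : Fin n → Fin n → ℤ} {L : Submodule ℤ (Fin n → ℤ)}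
    (h : IsTriBasis d T L) {v : Fin n → ℤ} (hv : IsRem d v) :
    Inserting d T (L ⊔ Submodule.span ℤ {v}) v 0 where
  toIsTriangular := h.toIsTriangular
  span := by rw [rowSpanWith, h.span]
  multiples_le l _ b hb := rowSpan_le_with T v l (h.multiples l b hb)
  multiples_gt l _ := h.multiples l
  rem := hv
  vec_zero b hb := absurd hb (by lia)

theorem Inserting.next {d : ℤ} {T : Fin n → Fin n → ℤ} {L : Submodule ℤ (Fin n → ℤ)}
    {v : Fin n → ℤ} {i : Fin n} (h : Inserting d T L v i) (h0 : v i = 0) :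
    Inserting d T L v (i + 1) where
  toIsTriangular := h.toIsTriangular
  span := h.span
  multiples_le l hl := by
    rcases Nat.eq_or_lt_of_le hl with rfl | hl
    · exact fun b hb => rowSpan_le_with T v _ (h.multiples_gt _ (Nat.lt_succ_self _) b hb)
    · exact h.multiples_le l (by lia)
  multiples_gt l hl := h.multiples_gt l (by lia)
  rem := h.rem
  vec_zero b hb := by
    rcases Nat.eq_or_lt_of_le (Nat.le_of_lt_succ hb) with h' | h'
    · rwa [Fin.ext h']
    · exact h.vec_zero b h'

theorem Inserting.finish {d : ℤ} {T : Fin n → Fin n → ℤ} {L : Submodule ℤ (Fin n → ℤ)}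
    {v : Fin n → ℤ} (h : Inserting d T L v n) : IsTriBasis d T L := by
  have hv : v = 0 := funext fun b => h.vec_zero b b.isLt
  have hs : ∀ l, rowSpanWith T v l = rowSpan T l := fun l => by simp [rowSpanWith, hv]
  refine ⟨h.toIsTriangular, by rw [← hs, h.span], fun l => ?_⟩
  by_cases hl : l ≤ n
  · exact hs l ▸ h.multiples_le l hl
  · exact h.multiples_gt l (by lia)

theorem Inserting.step {d : ℤ} (hd : d ≠ 0) {T : Fin n → Fin n → ℤ}
    {L : Submodule ℤ (Fin n → ℤ)} {v : Fin n → ℤ} {i : Fin n} (h : Inserting d T L v i)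
    (hpos : 0 < v i) :
    Inserting d (Function.update T i v) L (fun b => (T i b - T i i / v i * v b) % d) i := by
  set v' : Fin n → ℤ := fun b => (T i b - T i i / v i * v b) % d
  set T' := Function.update T i v
  have hT'i : T' i = v := Function.update_self ..
  have hT' : ∀ a, a ≠ i → T' a = T a := fun a ha => Function.update_of_ne ha ..
  have hTgt : ∀ l, i.val < l → rowSpan T' l = rowSpan T l := fun l hl =>
    le_antisymm
      (rowSpan_le fun a ha => by
        rw [hT' a (by rintro rfl; lia)]; exact mem_rowSpan T ha)
      (rowSpan_le fun a ha => by
        rw [← hT' a (by rintro rfl; lia)]; exact mem_rowSpan T' ha)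
  have hlow : ∀ b, b < i → T i b - T i i / v i * v b = 0 := fun b hb => by
    rw [h.zero i b hb, h.vec_zero b hb]; ring
  have hi : T i i - T i i / v i * v i = T i i % v i := by
    rw [Int.emod_def, mul_comm]
  have hvi := h.rem i
  have hiv : v' i = T i i % v i := by
    change (T i i - T i i / v i * v i) % d = _
    rw [hi, ← Int.emod_abs]
    exact Int.emod_eq_of_lt (Int.emod_nonneg _ hpos.ne')
      ((Int.emod_lt_of_pos _ hpos).trans hvi.2)
  have hw : (fun b => T i b - T i i / v i * v b - v' b) ∈ rowSpan T (i + 1) := by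
    refine (h.multiples_gt (i + 1) (Nat.lt_succ_self _)).mem
      (fun b => Int.dvd_self_sub_emod) fun b hb => ?_
    rcases Nat.eq_or_lt_of_le (Nat.le_of_lt_succ hb) with h' | h'
    · rw [Fin.ext h', hi, hiv, sub_self]
    · simp [v', hlow b h']
  have hle : ∀ l ≤ i.val, rowSpanWith T' v' l = rowSpanWith T v l := by
    intro l hl
    apply le_antisymm
    · refine rowSpanWith_le (fun a ha => ?_) ?_
      · by_cases hai : a = i
        · rw [hai, hT'i]; exact vec_mem_rowSpanWith T v l
        · rw [hT' a hai]; exact rowSpan_le_with T v l (mem_rowSpan T ha)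
      · have : v' = T i - (T i i / v i) • v - (fun b => T i b - T i i / v i * v b - v' b) := by
          ext b; simp
        rw [this]
        refine sub_mem (sub_mem (rowSpan_le_with T v l (mem_rowSpan T hl))
          (Submodule.smul_mem _ _ (vec_mem_rowSpanWith T v l))) ?_
        exact rowSpan_le_with T v l (rowSpan_anti T (by lia) hw)
    · have hv : v ∈ rowSpanWith T' v' l := by
        have := rowSpan_le_with T' v' l (mem_rowSpan T' (a := i) hl)
        rwa [hT'i] at this
      refine rowSpanWith_le (fun a ha => ?_) hv
      by_cases hai : a = i
      · have : T a = v' + (T i i / v i) • v + (fun b => T i b - T i i / v i * v b - v' b) := by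
          ext b; simp only [hai, Pi.add_apply, Pi.smul_apply, smul_eq_mul]; ring
        rw [this]
        refine add_mem (add_mem (vec_mem_rowSpanWith T' v' l) (Submodule.smul_mem _ _ hv)) ?_
        rw [← hTgt _ (Nat.lt_succ_self _)] at hw
        exact rowSpan_le_with T' v' l (rowSpan_anti T' (by lia) hw)
      · rw [← hT' a hai]; exact rowSpan_le_with T' v' l (mem_rowSpan T' ha)
  refine ⟨⟨fun a b hab => ?_, fun a => ?_, fun a b => ?_⟩, ?_, fun l hl => ?_, fun l hl => ?_,
    isRem_mod hd _, fun b hb => ?_⟩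
  · by_cases hai : a = i
    · subst hai; rw [hT'i]; exact h.vec_zero b hab
    · rw [hT' a hai]; exact h.zero a b hab
  · by_cases hai : a = i
    · subst hai; rw [hT'i]; exact hpos.ne'
    · rw [hT' a hai]; exact h.diag a
  · by_cases hai : a = i
    · subst hai; rw [hT'i, abs_of_nonneg (h.rem b).1]; exact (h.rem b).2.le
    · rw [hT' a hai]; exact h.bound a b
  · rw [hle 0 (Nat.zero_le _), h.span]
  · rw [hle l hl]; exact h.multiples_le l hl
  · rw [hTgt l hl]; exact h.multiples_gt l hl
  · change (_ : ℤ) % d = 0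
    rw [hlow b hb, Int.zero_emod]

/-- Two Euclidean steps halve the leading coefficient. -/
theorem emod_emod_lt_half {x y : ℤ} (hy : 0 < y) (hr : 0 < x % y) : 2 * (y % (x % y)) < y := by
  have h1 := Int.emod_lt_of_pos x hy
  have h2 := Int.emod_lt_of_pos y hr
  have h3 := Int.mul_ediv_add_emod y (x % y)
  have h4 : 1 ≤ y / (x % y) := by
    rw [Int.le_ediv_iff_mul_le hr]; lia
  nlinarith

theorem IsTriBasis.dvd {d : ℤ} {T : Fin n → Fin n → ℤ} {L : Submodule ℤ (Fin n → ℤ)}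
    (h : IsTriBasis d T L) {u : Fin n → ℤ} (hu : u ∈ L) {i : Fin n}
    (h0 : ∀ b < i, u b = 0) : T i i ∣ u i := by
  have hset : T '' {a | 0 ≤ a.val} = Set.range T := by simp
  rw [← h.span, rowSpan, hset, Submodule.mem_span_range_iff_exists_fun] at hu
  obtain ⟨c, rfl⟩ := hu
  have key : ∀ b, (∀ a < b, c a = 0) → (∑ a, c a • T a) b = c b * T b b := by
    intro b hb
    rw [Finset.sum_apply, Finset.sum_eq_single b]
    · rfl
    · intro a _ hab
      rcases lt_or_gt_of_ne hab with h' | h'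
      · simp [hb a h']
      · simp [h.zero a b h']
    · simp
  have hc : ∀ b < i, c b = 0 := by
    intro b
    induction b using WellFoundedLT.induction with
    | ind b ih =>
      intro hb
      have := h0 b hb
      rw [key b fun a ha => ih a ha (ha.trans hb)] at this
      exact (mul_eq_zero.1 this).resolve_right (h.diag b)
  rw [key i hc]
  exact Dvd.intro_left _ rfl

/-- The entries of `v` before `i` are remainders modulo the diagonal of `T`. -/
def IsReduced (T : Fin n → Fin n → ℤ) (v : Fin n → ℤ) (i : ℕ) : Prop :=
  ∀ b : Fin n, b.val < i → v b < |T b b|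

theorem IsTriBasis.reduce {d : ℤ} {T : Fin n → Fin n → ℤ}
    {L : Submodule ℤ (Fin n → ℤ)} (h : IsTriBasis d T L) {v : Fin n → ℤ} (hv : IsRem d v)
    {i : Fin n} (hr : IsReduced T v i) :
    IsReduced T (fun b => (v b - v i / T i i * T i b) % d) (i + 1) ∧
      v - (fun b => (v b - v i / T i i * T i b) % d) ∈ L := by
  constructor
  · intro b hb
    rcases Nat.eq_or_lt_of_le (Nat.le_of_lt_succ hb) with h' | h'
    · rw [Fin.ext h']
      have h1 : v i - v i / T i i * T i i = v i % T i i := by rw [Int.emod_def, mul_comm]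
      have h2 := Int.emod_lt_abs (v i) (h.diag i)
      simp only [h1]
      rw [← Int.emod_abs, Int.emod_eq_of_lt (Int.emod_nonneg _ (h.diag i))
        (h2.trans_le (h.bound i i))]
      exact h2
    · simp only [h.zero i b h', mul_zero, sub_zero]
      rw [← Int.emod_abs, Int.emod_eq_of_lt (hv b).1 (hv b).2]
      exact hr b h'
  · have hT : T i ∈ L := h.span ▸ mem_rowSpan T (Nat.zero_le _)
    have hd := (h.multiples 0).mem
      (w := fun b => v b - v i / T i i * T i b - (v b - v i / T i i * T i b) % d)
      (fun b => Int.dvd_self_sub_emod) fun b hb => absurd hb (by lia)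
    rw [h.span] at hd
    have : (v - fun b => (v b - v i / T i i * T i b) % d) = (v i / T i i) • T i +
        fun b => v b - v i / T i i * T i b - (v b - v i / T i i * T i b) % d := by
      ext b; simp; ring
    rw [this]
    exact add_mem (Submodule.smul_mem _ _ hT) hd

/-! ### The lattice of a linear congruence -/

variable {m k : ℕ}

/-- The solutions `(y, z)` of `y = W z` modulo `d` with `z` zero modulo `d` from index `j` on. -/
def congrLattice (d : ℤ) (W : Matrix (Fin m) (Fin k) ℤ) (j : ℕ) :
    Submodule ℤ (Fin (m + k) → ℤ) where
  carrier := {u | (∀ i, d ∣ u (Fin.castAdd k i) - W.mulVec (fun l => u (Fin.natAdd m l)) i) ∧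
    ∀ l : Fin k, j ≤ l.val → d ∣ u (Fin.natAdd m l)}
  zero_mem' := ⟨fun i => by simp [Matrix.mulVec, dotProduct], fun _ _ => by simp⟩
  add_mem' := by
    rintro u v ⟨hu, hu'⟩ ⟨hv, hv'⟩
    refine ⟨fun i => ?_, fun l hl => dvd_add (hu' l hl) (hv' l hl)⟩
    have : (fun l => (u + v) (Fin.natAdd m l)) =
      (fun l => u (Fin.natAdd m l)) + fun l => v (Fin.natAdd m l) := rfl
    rw [this, Matrix.mulVec_add, Pi.add_apply, Pi.add_apply, add_sub_add_comm]
    exact dvd_add (hu i) (hv i)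
  smul_mem' := by
    rintro c u ⟨hu, hu'⟩
    refine ⟨fun i => ?_, fun l hl => (hu' l hl).mul_left c⟩
    have : (fun l => (c • u) (Fin.natAdd m l)) = c • fun l => u (Fin.natAdd m l) := rfl
    rw [this, Matrix.mulVec_smul, Pi.smul_apply, Pi.smul_apply, ← smul_sub]
    exact (hu i).mul_left c

theorem dvd_mulVec {d : ℤ} (W : Matrix (Fin m) (Fin k) ℤ) {z : Fin k → ℤ} (h : ∀ l, d ∣ z l)
    (i : Fin m) : d ∣ W.mulVec z i := by
  rw [Matrix.mulVec, dotProduct]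
  exact Finset.dvd_sum fun l _ => (h l).mul_left _

theorem mem_congrLattice_of_dvd {d : ℤ} (W : Matrix (Fin m) (Fin k) ℤ) (j : ℕ)
    {u : Fin (m + k) → ℤ} (h : ∀ b, d ∣ u b) : u ∈ congrLattice d W j :=
  ⟨fun _ => dvd_sub (h _) (dvd_mulVec W (fun _ => h _) _), fun _ _ => h _⟩

theorem isTriBasis_diagonal {d : ℤ} (hd : d ≠ 0) (W : Matrix (Fin m) (Fin k) ℤ) :
    IsTriBasis d (fun a b => if a = b then d else 0) (congrLattice d W 0) := by
  have hrow : ∀ a : Fin (m + k), (fun b => if a = b then d else 0) = Pi.single a d := by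
    intro a; ext b; simp [Pi.single_apply, eq_comm]
  have hm : ∀ l, HasMultiples d (rowSpan (n := m + k) (fun a b => if a = b then d else 0) l) l := by
    intro l b hb
    rw [← hrow b]
    exact mem_rowSpan (fun a b : Fin (m + k) => if a = b then d else 0) hb
  refine ⟨⟨fun a b h => if_neg h.ne', fun a => by simpa using hd, fun a b => ?_⟩,
    le_antisymm (rowSpan_le fun a _ => ?_) fun u hu => ?_, hm⟩
  · split_ifs <;> simp
  · refine mem_congrLattice_of_dvd W 0 fun b => ?_
    split_ifs <;> simp
  · refine (hm 0).mem (fun b => ?_) fun b hb => absurd hb (by lia)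
    have h2 : ∀ l, d ∣ u (Fin.natAdd m l) := fun l => hu.2 l (Nat.zero_le _)
    refine Fin.addCases (fun i => ?_) h2 b
    exact (dvd_sub_left (dvd_mulVec W h2 i)).1 (hu.1 i)

theorem congrLattice_succ {d : ℤ} {W : Matrix (Fin m) (Fin k) ℤ} {j : Fin k}
    {v : Fin (m + k) → ℤ} (h1 : ∀ i, d ∣ v (Fin.castAdd k i) - W i j)
    (h2 : ∀ l, d ∣ v (Fin.natAdd m l) - if l = j then 1 else 0) :
    congrLattice d W (j + 1) = congrLattice d W j ⊔ Submodule.span ℤ {v} := by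
  have hW : ∀ i, d ∣ v (Fin.castAdd k i) - W.mulVec (fun l => v (Fin.natAdd m l)) i := by
    intro i
    have h3 : W.mulVec (fun l => v (Fin.natAdd m l)) i - W i j =
        W.mulVec (fun l => v (Fin.natAdd m l) - if l = j then 1 else 0) i := by
      simp [Matrix.mulVec, dotProduct, mul_sub, Finset.sum_sub_distrib]
    have h4 : d ∣ W.mulVec (fun l => v (Fin.natAdd m l)) i - W i j :=
      h3 ▸ dvd_mulVec W h2 i
    have := dvd_sub (h1 i) h4
    rwa [sub_sub_sub_cancel_right] at this
  have hv : v ∈ congrLattice d W (j + 1) := by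
    refine ⟨hW, fun l hl => ?_⟩
    have := h2 l
    rwa [if_neg (by rintro rfl; lia), sub_zero] at this
  apply le_antisymm
  · intro u hu
    have : u = (u - u (Fin.natAdd m j) • v) + u (Fin.natAdd m j) • v := by simp
    rw [this]
    refine add_mem (Submodule.mem_sup_left ?_)
      (Submodule.mem_sup_right (Submodule.smul_mem _ _ (Submodule.mem_span_singleton_self v)))
    refine ⟨(sub_mem hu (Submodule.smul_mem _ _ hv)).1, fun l hl => ?_⟩
    rcases Nat.eq_or_lt_of_le hl with h' | h'
    · obtain rfl := Fin.ext h'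
      have := (h2 j).mul_left (u (Fin.natAdd m j))
      rw [if_pos rfl, mul_sub, mul_one] at this
      rw [Pi.sub_apply, Pi.smul_apply, smul_eq_mul, ← dvd_neg, neg_sub]
      exact this
    · exact (sub_mem hu (Submodule.smul_mem _ _ hv)).2 l h'
  · refine sup_le (fun u hu => ⟨hu.1, fun l hl => hu.2 l (by lia)⟩) ?_
    simpa [Submodule.span_le] using hv

end Lattice

/-! ### Indices of column lattices -/

namespace Matrix

variable {m : ℕ} {ι : Type*} [Fintype ι]

/-- The lattice generated by the columns. -/
def colLattice (A : Matrix (Fin m) ι ℤ) : AddSubgroup (Fin m → ℤ) :=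
  (LinearMap.range A.mulVecLin).toAddSubgroup

theorem mem_colLattice {A : Matrix (Fin m) ι ℤ} {y : Fin m → ℤ} :
    y ∈ A.colLattice ↔ ∃ x, A.mulVec x = y := by
  simp [colLattice]

theorem index_colLattice (B : Matrix (Fin m) (Fin m) ℤ) (hB : B.det ≠ 0) :
    B.colLattice.index = B.det.natAbs := by
  have hinj : Function.Injective B.mulVecLin := by
    rw [← LinearMap.ker_eq_bot, LinearMap.ker_eq_bot']
    exact fun v hv => eq_zero_of_mulVec_eq_zero hB hv
  have h := Submodule.natAbs_det_equiv _ (LinearEquiv.ofInjective B.mulVecLin hinj)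
  have h' : ((LinearMap.range B.mulVecLin).subtype ∘ₗ AddMonoidHom.toIntLinearMap
      (LinearEquiv.ofInjective B.mulVecLin hinj : (Fin m → ℤ) →+ LinearMap.range B.mulVecLin)) =
      Matrix.toLin' B := by
    ext; simp
  rw [h', LinearMap.det_toLin'] at h
  rw [h]
  rfl

theorem gcdMinors_dvd_det [DecidableEq ι] (A : Matrix (Fin m) ι ℤ) (Y : Fin m → ι → ℤ) :
    gcdMinors A ∣ (Matrix.of fun i => A.mulVec (Y i)).det := by
  have h : (Matrix.of fun i => A.mulVec (Y i)) = fun i => ∑ c, Y i c • Aᵀ c := by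
    ext i j
    simp [mulVec, dotProduct, Finset.sum_apply, mul_comm]
  change _ ∣ detRowAlternating _
  rw [h, ← AlternatingMap.coe_multilinearMap, MultilinearMap.map_sum]
  refine Finset.dvd_sum fun f _ => ?_
  rw [MultilinearMap.map_smul_univ]
  refine Dvd.dvd.mul_left ?_ _
  by_cases hf : Function.Injective f
  · have h1 : (A.submatrix id f).det = detRowAlternating fun i => Aᵀ (f i) := by
      rw [← det_transpose]; rfl
    exact h1 ▸ Finset.gcd_dvd (Finset.mem_univ (⟨f, hf⟩ : Fin m ↪ ι))
  · obtain ⟨a, b, hab, hne⟩ : ∃ a b, f a = f b ∧ a ≠ b := by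
      simpa [Function.Injective] using hf
    rw [AlternatingMap.coe_multilinearMap,
      AlternatingMap.map_eq_zero_of_eq _ (fun i => Aᵀ (f i)) (congrArg Aᵀ hab) hne]
    exact dvd_zero _

end Matrix

section

variable {m k : ℕ} {B : Matrix (Fin m) (Fin m) ℤ} (N : Matrix (Fin m) (Fin k) ℤ)

open Matrix

theorem colLattice_le_fromCols : B.colLattice ≤ (fromCols B N).colLattice := by
  intro y hy
  obtain ⟨x, rfl⟩ := mem_colLattice.1 hy
  exact mem_colLattice.2 ⟨Sum.elim x 0, by simp [fromCols_mulVec]⟩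

theorem gcdMinors_ne_zero (hB : B.det ≠ 0) : gcdMinors (fromCols B N) ≠ 0 := by
  intro h
  rw [gcdMinors, Finset.gcd_eq_zero_iff] at h
  refine hB ?_
  have := h ⟨Sum.inl, Sum.inl_injective⟩ (Finset.mem_univ _)
  rwa [show (fromCols B N).submatrix id (⟨Sum.inl, Sum.inl_injective⟩ : Fin m ↪ Fin m ⊕ Fin k) = B
    from by ext; rfl] at this

theorem gcdMinors_dvd_index (hB : B.det ≠ 0) :
    gcdMinors (fromCols B N) ∣ ((fromCols B N).colLattice.index : ℤ) := by
  have hinj : Function.Injective B.mulVecLin := by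
    rw [← LinearMap.ker_eq_bot, LinearMap.ker_eq_bot']
    exact fun v hv => eq_zero_of_mulVec_eq_zero hB hv
  have hle : LinearMap.range B.mulVecLin ≤ LinearMap.range (fromCols B N).mulVecLin :=
    colLattice_le_fromCols N
  have hrank : Module.finrank ℤ (LinearMap.range (fromCols B N).mulVecLin) = m := by
    apply le_antisymm
    · exact (Submodule.finrank_le _).trans (by simp)
    · have := Submodule.finrank_mono hle
      rwa [LinearMap.finrank_range_of_inj hinj, Module.finrank_fin_fun] at this
  let b := Module.finBasisOfFinrankEq ℤ (LinearMap.range (fromCols B N).mulVecLin) hrank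
  have hb : ∀ i, ∃ y, (fromCols B N).mulVec y = b i := fun i => (b i).2
  choose Y hY using hb
  rw [AddSubgroup.index_eq_natAbs_det (Pi.basisFun ℤ (Fin m)) _ b, Int.dvd_natAbs]
  have h := gcdMinors_dvd_det (fromCols B N) Y
  simp_rw [hY] at h
  rwa [Pi.basisFun_det]

theorem relIndex_mul_gcdMinors_le (hB : B.det ≠ 0) :
    (B.colLattice.relIndex (fromCols B N).colLattice : ℤ) * gcdMinors (fromCols B N) ≤ |B.det| := by
  have h := AddSubgroup.relIndex_mul_index (colLattice_le_fromCols (B := B) N)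
  rw [index_colLattice B hB] at h
  rw [Int.abs_eq_natAbs, ← h, Nat.cast_mul]
  refine mul_le_mul_of_nonneg_left (Int.le_of_dvd ?_ (gcdMinors_dvd_index N hB)) (by positivity)
  refine Nat.cast_pos.2 (Nat.pos_of_ne_zero fun h0 => ?_)
  rw [h0, mul_zero] at h
  exact hB (Int.natAbs_eq_zero.1 h.symm)

theorem sum_add_one_le_prod {ι : Type*} (s : Finset ι) (f : ι → ℕ) :
    ∑ i ∈ s, f i + 1 ≤ ∏ i ∈ s, (f i + 1) := by
  classical
  induction s using Finset.induction_on with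
  | empty => simp
  | insert a s ha ih =>
    rw [Finset.sum_insert ha, Finset.prod_insert ha]
    have : 1 ≤ ∏ i ∈ s, (f i + 1) := Nat.succ_le_of_lt (Finset.prod_pos fun _ _ => Nat.succ_pos _)
    nlinarith

/-- If different vectors below `z` have different classes, then `z` is small. -/
theorem sum_add_one_le_relIndex (hB : B.det ≠ 0) {z : Fin k → ℕ}
    (hz : ∀ u v : Fin k → ℤ, (∀ j, 0 ≤ u j ∧ u j ≤ z j) → (∀ j, 0 ≤ v j ∧ v j ≤ z j) →
      N.mulVec (u - v) ∈ B.colLattice → u = v) :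
    ∑ j, z j + 1 ≤ B.colLattice.relIndex (fromCols B N).colLattice := by
  refine (sum_add_one_le_prod _ _).trans ?_
  let box : Finset (Fin k → ℕ) := Fintype.piFinset fun j => Finset.range (z j + 1)
  have hbox : box.card = ∏ j, (z j + 1) := by simp [box]
  rw [← hbox, ← Nat.card_eq_finsetCard, AddSubgroup.relIndex, AddSubgroup.index]
  have hmem : ∀ u : Fin k → ℤ, N.mulVec u ∈ (fromCols B N).colLattice := fun u =>
    mem_colLattice.2 ⟨Sum.elim 0 u, by simp [fromCols_mulVec]⟩
  have hfin : Finite ((fromCols B N).colLattice ⧸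
      B.colLattice.addSubgroupOf (fromCols B N).colLattice) := by
    apply Nat.finite_of_card_ne_zero
    have h := AddSubgroup.relIndex_mul_index (colLattice_le_fromCols (B := B) N)
    rw [index_colLattice B hB] at h
    intro h0
    change B.colLattice.relIndex _ = 0 at h0
    rw [h0, zero_mul] at h
    exact hB (Int.natAbs_eq_zero.1 h.symm)
  refine Nat.card_le_card_of_injective (fun u : box =>
    (QuotientAddGroup.mk ⟨N.mulVec fun j => (u.1 j : ℤ), hmem _⟩ :
      (fromCols B N).colLattice ⧸ B.colLattice.addSubgroupOf (fromCols B N).colLattice)) ?_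
  rintro ⟨u, hu⟩ ⟨v, hv⟩ huv
  have hle : ∀ w ∈ box, ∀ j, 0 ≤ (w j : ℤ) ∧ (w j : ℤ) ≤ z j := fun w hw j =>
    ⟨by positivity, by
      have := Finset.mem_range.1 (Fintype.mem_piFinset.1 hw j)
      exact_mod_cast Nat.le_of_lt_succ this⟩
  rw [QuotientAddGroup.eq, AddSubgroup.mem_addSubgroupOf] at huv
  have := hz (fun j => (v j : ℤ)) (fun j => (u j : ℤ)) (hle v hv) (hle u hu) (by
    rw [mulVec_sub, sub_eq_neg_add]; exact huv)
  ext j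
  exact_mod_cast (congrFun this j).symm

/-! ### The cone -/

theorem euclideanCol_sum {ι : Type*} [Fintype ι] (M : Matrix (Fin m) ι ℤ) (c : ι → ℝ) :
    ∑ j, c j • euclideanCol M j = WithLp.toLp 2 ((M.map (Int.cast : ℤ → ℝ)).mulVec c) := by
  ext i
  simp [euclideanCol, mulVec, dotProduct, mul_comm]

theorem mem_colCone_iff (hB : B.det ≠ 0) {y : EuclideanSpace ℝ (Fin m)} :
    y ∈ colCone B ↔ ∀ j, 0 ≤ ((B.map (Int.cast : ℤ → ℝ))⁻¹.mulVec y.ofLp) j := by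
  have hdet : IsUnit (B.map (Int.cast : ℤ → ℝ)).det := by
    have : (B.map (Int.cast : ℤ → ℝ)).det = (B.det : ℝ) := by
      simpa using (RingHom.map_det (Int.castRingHom ℝ) B).symm
    rw [this]
    exact (Int.cast_ne_zero.2 hB).isUnit
  constructor
  · rintro ⟨c, hc, rfl⟩
    rw [euclideanCol_sum]
    simpa [mulVec_mulVec, nonsing_inv_mul _ hdet] using hc
  · intro h
    refine ⟨_, h, ?_⟩
    rw [euclideanCol_sum, mulVec_mulVec, mul_nonsing_inv _ hdet, one_mulVec]

theorem isClosed_colCone (hB : B.det ≠ 0) : IsClosed (colCone B) := by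
  have : colCone B = ⋂ j, {y | 0 ≤ ((B.map (Int.cast : ℤ → ℝ))⁻¹.mulVec y.ofLp) j} := by
    ext y
    simp [mem_colCone_iff hB]
  rw [this]
  refine isClosed_iInter fun j => isClosed_le continuous_const ?_
  simp only [mulVec, dotProduct]
  fun_prop

theorem mem_of_dist_frontier {E : Type*} [NormedAddCommGroup E] [NormedSpace ℝ E] {C : Set E}
    (hC : IsClosed C) {t : ℝ} {x y : E} (hx : x ∈ C) (hfr : ∀ z ∈ frontier C, t ≤ dist x z)
    (hy : dist x y ≤ t) : y ∈ C := by
  by_contra hyC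
  obtain ⟨f, hf, hfC⟩ : ∃ f ∈ segment ℝ x y, f ∈ frontier C := by
    by_contra! h
    have hcov : segment ℝ x y ⊆ interior C ∪ Cᶜ := fun f hf => by
      by_cases hfC : f ∈ C
      · left
        by_contra hint
        exact h f hf (by rw [hC.frontier_eq]; exact ⟨hfC, hint⟩)
      · exact Or.inr hfC
    have hxint : x ∈ interior C := (hcov (left_mem_segment ℝ x y)).resolve_right fun h => h hx
    obtain ⟨w, -, hw1, hw2⟩ := (convex_segment x y).isPreconnected _ _ isOpen_interior
      hC.isOpen_compl hcov ⟨x, left_mem_segment ℝ x y, hxint⟩ ⟨y, right_mem_segment ℝ x y, hyC⟩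
    exact hw2 (interior_subset hw1)
  have h1 := dist_add_dist_of_mem_segment hf
  have h2 : 0 < dist f y := by
    rw [dist_pos]
    rintro rfl
    exact hyC (hC.frontier_subset hfC)
  have h3 := hfr f hfC
  linarith

theorem norm_mulVec_le (z : Fin k → ℕ) :
    ‖(WithLp.toLp 2 fun i => ((N.mulVec fun j => (z j : ℤ)) i : ℝ) : EuclideanSpace ℝ (Fin m))‖ ≤
      maxColLength N * ∑ j, (z j : ℝ) := by
  have h : (WithLp.toLp 2 fun i => ((N.mulVec fun j => (z j : ℤ)) i : ℝ) :
      EuclideanSpace ℝ (Fin m)) = ∑ j, (z j : ℝ) • euclideanCol N j := by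
    rw [euclideanCol_sum]
    ext i
    simp [mulVec, dotProduct]
  rw [h, Finset.mul_sum]
  refine (norm_sum_le _ _).trans (Finset.sum_le_sum fun j _ => ?_)
  rw [norm_smul, mul_comm, Real.norm_natCast]
  exact mul_le_mul_of_nonneg_right
    (le_ciSup (f := fun j => ‖euclideanCol N j‖) (Set.finite_range _).bddAbove j)
    (Nat.cast_nonneg _)

/-- A solution of the congruence that is small in the sense of `sum_add_one_le_relIndex` lifts to
a nonnegative solution of the system, if the right hand side is deep in the cone. -/
theorem nonneg_of_mem_deepCone (hB : B.det ≠ 0) {b x : Fin m → ℤ} {z : Fin k → ℤ}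
    (hb : (WithLp.toLp 2 fun i => (b i : ℝ)) ∈ deepCone B (maxColLength N *
      ((|B.det| : ℤ) / (gcdMinors (fromCols B N) : ℝ) - 1)))
    (hz0 : ∀ j, 0 ≤ z j)
    (hz : ∀ u v : Fin k → ℤ, (∀ j, 0 ≤ u j ∧ u j ≤ z j) → (∀ j, 0 ≤ v j ∧ v j ≤ z j) →
      N.mulVec (u - v) ∈ B.colLattice → u = v)
    (hx : B.mulVec x + N.mulVec z = b) (i : Fin m) : 0 ≤ x i := by
  lift z to Fin k → ℕ using hz0
  have hg : (0 : ℝ) < gcdMinors (fromCols B N) := by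
    have h0 : 0 ≤ gcdMinors (fromCols B N) :=
      Int.nonneg_of_normalize_eq_self Finset.normalize_gcd
    exact_mod_cast lt_of_le_of_ne h0 (gcdMinors_ne_zero N hB).symm
  have hs : ∑ j, (z j : ℝ) ≤ (|B.det| : ℤ) / (gcdMinors (fromCols B N) : ℝ) - 1 := by
    rw [le_sub_iff_add_le, le_div_iff₀ hg]
    have h1 : (∑ j, (z j : ℝ) + 1) ≤ B.colLattice.relIndex (fromCols B N).colLattice := by
      exact_mod_cast sum_add_one_le_relIndex N hB hz
    refine (mul_le_mul_of_nonneg_right h1 hg.le).trans ?_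
    exact_mod_cast relIndex_mul_gcdMinors_le N hB
  have hl : 0 ≤ maxColLength N := Real.iSup_nonneg fun _ => norm_nonneg _
  have hmem : (WithLp.toLp 2 fun i => ((B.mulVec x) i : ℝ)) ∈ colCone B := by
    refine mem_of_dist_frontier (isClosed_colCone hB) hb.1 hb.2 ?_
    refine le_trans (le_of_eq ?_) ((norm_mulVec_le N z).trans (mul_le_mul_of_nonneg_left hs hl))
    rw [dist_eq_norm]
    congr 1
    ext i
    simp [← hx]
  rw [mem_colCone_iff hB] at hmem
  have hcast : (fun i => ((B.mulVec x) i : ℝ)) =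
      (B.map (Int.cast : ℤ → ℝ)).mulVec fun i => (x i : ℝ) := by
    ext i
    simp [mulVec, dotProduct]
  have hdet : IsUnit (B.map (Int.cast : ℤ → ℝ)).det := by
    have : (B.map (Int.cast : ℤ → ℝ)).det = (B.det : ℝ) := by
      simpa using (RingHom.map_det (Int.castRingHom ℝ) B).symm
    rw [this]
    exact (Int.cast_ne_zero.2 hB).isUnit
  have := hmem i
  rw [hcast, mulVec_mulVec, nonsing_inv_mul _ hdet, one_mulVec] at this
  exact_mod_cast this

end

/-! ### From the triangular basis to a solution -/

section

open Matrix Lattice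

variable {m k : ℕ} {B M : Matrix (Fin m) (Fin m) ℤ} {N : Matrix (Fin m) (Fin k) ℤ}
  {b : Fin m → ℤ} {d : ℤ} {T : Fin (m + k) → Fin (m + k) → ℤ} {v₀ v : Fin (m + k) → ℤ}

theorem smul_one_mulVec (d : ℤ) (x : Fin m → ℤ) :
    (d • (1 : Matrix (Fin m) (Fin m) ℤ)).mulVec x = d • x := by
  rw [smul_mulVec, one_mulVec]

theorem head_eq_zero_of_solution (hMB : M * B = d • 1)
    (hT : IsTriBasis d T (congrLattice d (M * N) k))
    (h₀ : ∀ i, d ∣ v₀ (Fin.castAdd k i) + M.mulVec b i) (h₀' : ∀ j, d ∣ v₀ (Fin.natAdd m j))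
    (hv : IsRem d v) (hr : IsReduced T v (m + k)) (hvv : v₀ - v ∈ congrLattice d (M * N) k)
    {x : Fin m ⊕ Fin k → ℤ} (hx : (fromCols B N).mulVec x = b) (i : Fin m) :
    v (Fin.castAdd k i) = 0 := by
  obtain ⟨y, z, rfl⟩ : ∃ y z, x = Sum.elim y z := ⟨x ∘ Sum.inl, x ∘ Sum.inr, by simp⟩
  rw [fromCols_mulVec] at hx
  have hb : M.mulVec b = d • y + (M * N).mulVec z := by
    rw [← hx, mulVec_add, mulVec_mulVec, mulVec_mulVec]
    simp [hMB]
  let u : Fin (m + k) → ℤ := Fin.append 0 z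
  have hu : v₀ - u ∈ congrLattice d (M * N) k := by
    refine ⟨fun i => ?_, fun l hl => absurd hl (by lia)⟩
    have h1 : (fun l => (v₀ - u) (Fin.natAdd m l)) = (fun l => v₀ (Fin.natAdd m l)) - z := by
      ext l; simp [u]
    have h2 := h₀ i
    have h3 := dvd_mulVec (M * N) h₀' i
    rw [hb, Pi.add_apply, Pi.smul_apply, smul_eq_mul] at h2
    rw [h1, mulVec_sub, Pi.sub_apply, Pi.sub_apply]
    have : v₀ (Fin.castAdd k i) - u (Fin.castAdd k i) -
        ((M * N).mulVec (fun l => v₀ (Fin.natAdd m l)) i - (M * N).mulVec z i) =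
        v₀ (Fin.castAdd k i) + (d * y i + (M * N).mulVec z i) - d * y i -
        (M * N).mulVec (fun l => v₀ (Fin.natAdd m l)) i := by
      simp [u]; ring
    rw [this]
    exact dvd_sub (dvd_sub h2 (dvd_mul_right d _)) h3
  have hvu : v - u ∈ congrLattice d (M * N) k := by
    have := sub_mem hu hvv
    rwa [sub_sub_sub_cancel_left] at this
  have huc : ∀ i, (v - u) (Fin.castAdd k i) = v (Fin.castAdd k i) := fun i => by simp [u]
  induction i using WellFoundedLT.induction with
  | ind i ih =>
    have hdvd := hT.dvd hvu (i := Fin.castAdd k i) fun c hc => by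
      have hcm : c.val < m := lt_trans hc i.isLt
      have := ih ⟨c, hcm⟩ hc
      rwa [← huc] at this
    rw [huc] at hdvd
    refine Int.eq_zero_of_abs_lt_dvd ((abs_dvd _ _).2 hdvd) ?_
    rw [abs_of_nonneg (hv _).1]
    exact hr _ (Fin.castAdd k i).isLt

theorem solution_of_head_eq_zero (hd : d ≠ 0) (hB : B.det ≠ 0) (hMB : M * B = d • 1)
    (hBM : B * M = d • 1)
    (hdeep : (WithLp.toLp 2 fun i => (b i : ℝ)) ∈ deepCone B (maxColLength N *
      ((|B.det| : ℤ) / (gcdMinors (fromCols B N) : ℝ) - 1)))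
    (hT : IsTriBasis d T (congrLattice d (M * N) k))
    (h₀ : ∀ i, d ∣ v₀ (Fin.castAdd k i) + M.mulVec b i) (h₀' : ∀ j, d ∣ v₀ (Fin.natAdd m j))
    (hv : IsRem d v) (hr : IsReduced T v (m + k)) (hvv : v₀ - v ∈ congrLattice d (M * N) k)
    (hv0 : ∀ i, v (Fin.castAdd k i) = 0) {x : Fin m → ℤ} {z : Fin k → ℤ}
    (hz : ∀ j, z j = v (Fin.natAdd m j))
    (hx : ∀ i, x i = M.mulVec (b - N.mulVec z) i / d) :
    (∀ j, 0 ≤ Sum.elim x z j) ∧ (fromCols B N).mulVec (Sum.elim x z) = b := by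
  have hdvd : ∀ i, d ∣ M.mulVec (b - N.mulVec z) i := by
    intro i
    have h1 := hvv.1 i
    have h2 := h₀ i
    have h3 := dvd_mulVec (M * N) h₀' i
    have h4 : (fun l => (v₀ - v) (Fin.natAdd m l)) = (fun l => v₀ (Fin.natAdd m l)) - z := by
      ext l; simp [hz]
    rw [h4, mulVec_sub, Pi.sub_apply, Pi.sub_apply, hv0] at h1
    rw [mulVec_sub, mulVec_mulVec, Pi.sub_apply]
    have := dvd_sub (dvd_sub h2 h1) h3
    rwa [show v₀ (Fin.castAdd k i) + M.mulVec b i - (v₀ (Fin.castAdd k i) - 0 -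
      ((M * N).mulVec (fun l => v₀ (Fin.natAdd m l)) i - (M * N).mulVec z i)) -
      (M * N).mulVec (fun l => v₀ (Fin.natAdd m l)) i =
      M.mulVec b i - (M * N).mulVec z i by ring] at this
  have hdx : d • x = M.mulVec (b - N.mulVec z) := by
    ext i
    rw [Pi.smul_apply, smul_eq_mul, hx, Int.mul_ediv_cancel' (hdvd i)]
  have hsol : B.mulVec x + N.mulVec z = b := by
    have h1 : d • B.mulVec x = d • (b - N.mulVec z) := by
      rw [← mulVec_smul, hdx, mulVec_mulVec, hBM, smul_one_mulVec]
    have h2 : B.mulVec x = b - N.mulVec z := by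
      ext i
      have := congrFun h1 i
      simpa [hd] using this
    rw [h2, sub_add_cancel]
  refine ⟨?_, by simpa [fromCols_mulVec] using hsol⟩
  have hz0 : ∀ j, 0 ≤ z j := fun j => hz j ▸ (hv _).1
  have hinj : ∀ u w : Fin k → ℤ, (∀ j, 0 ≤ u j ∧ u j ≤ z j) → (∀ j, 0 ≤ w j ∧ w j ≤ z j) →
      N.mulVec (u - w) ∈ B.colLattice → u = w := by
    intro u w hu hw huw
    obtain ⟨y, hy⟩ := mem_colLattice.1 huw
    have hmem : (Fin.append 0 (u - w) : Fin (m + k) → ℤ) ∈ congrLattice d (M * N) k := by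
      refine ⟨fun i => ?_, fun l hl => absurd hl (by lia)⟩
      have h1 : (fun l => (Fin.append 0 (u - w) : Fin (m + k) → ℤ) (Fin.natAdd m l)) = u - w := by
        ext l; simp
      rw [h1, ← mulVec_mulVec, ← hy, mulVec_mulVec, hMB, smul_one_mulVec]
      simp
    ext j
    induction j using WellFoundedLT.induction with
    | ind j ih =>
      have hdvd := hT.dvd hmem (i := Fin.natAdd m j) fun c hc => by
        induction c using Fin.addCases with
        | left i => simp
        | right l => simp [ih l (by simpa using hc)]
      rw [Fin.append_right, Pi.sub_apply] at hdvd
      refine sub_eq_zero.1 (Int.eq_zero_of_abs_lt_dvd ((abs_dvd _ _).2 hdvd) ?_)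
      refine lt_of_le_of_lt ?_ (hr (Fin.natAdd m j) (Fin.natAdd m j).isLt)
      rw [← hz, abs_le]
      constructor <;> linarith [(hu j).1, (hu j).2, (hw j).1, (hw j).2]
  rintro (i | j)
  · exact nonneg_of_mem_deepCone N hB hdeep hz0 hinj hsol i
  · exact hz0 j

end

/-! ### Filling vectors and matrices -/

namespace BitRAM

theorem bits_natCast_le {N N' β : ℕ} (h : N ≤ N') (hN : bits N' ≤ β) : bits N ≤ β := by
  rw [bits_le_iff] at hN ⊢
  rw [abs_of_nonneg (by positivity)] at hN ⊢
  exact lt_of_le_of_lt (by exact_mod_cast h) hN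

theorem bits_le_of_abs_le {z y : ℤ} {β : ℕ} (h : |z| ≤ y) (hy : y < 2 ^ β) : bits z ≤ β :=
  bits_le_iff.2 (h.trans_lt hy)

/-- The extension of a vector by zero. -/
def extend {L : ℕ} (f : Fin L → ℤ) (c : ℕ) : ℤ := if h : c < L then f ⟨c, h⟩ else 0

theorem extend_of_lt {L : ℕ} (f : Fin L → ℤ) {c : ℕ} (h : c < L) : extend f c = f ⟨c, h⟩ :=
  dif_pos h

theorem sum_extend {L : ℕ} (f : Fin L → ℤ) : ∑ i ∈ Finset.range L, extend f i = ∑ i, f i := by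
  rw [Finset.sum_range]
  exact Finset.sum_congr rfl fun i _ => extend_of_lt f i.isLt

theorem bits_sum_extend_le {L : ℕ} {f : Fin L → ℤ} {Y : ℤ} {β : ℕ} (hf : ∀ i, |f i| ≤ Y)
    (hY : L * Y < 2 ^ β) {j : ℕ} (hj : j ≤ L) :
    bits (∑ i ∈ Finset.range j, extend f i) ≤ β := by
  refine bits_le_of_abs_le ?_ hY
  refine (Finset.abs_sum_le_sum_abs _ _).trans ?_
  refine (Finset.sum_le_sum_of_subset_of_nonneg (Finset.range_subset_range.2 hj)
    fun i _ _ => abs_nonneg _).trans ?_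
  refine (Finset.sum_le_card_nsmul _ _ Y fun i hi => ?_).trans (by simp)
  rw [extend_of_lt f (Finset.mem_range.1 hi)]
  exact hf _

variable {a : ℕ} {base len R e f : Expr} {β : ℕ} {s : Mem}

theorem does_sumTo_fin {N : ℕ} (val : Fin N → ℤ) (Y : ℤ) (hN : bits N ≤ β)
    (hR : ∀ s', s.EqOff [4, 5] [] s' → R.eval s' = N)
    (he : ∀ (l : Fin N) s', s.EqOff [4, 5] [] s' → s'.var 4 = (l : ℕ) → e.eval s' = val l)
    (hval : ∀ l, |val l| ≤ Y) (hY : N * Y < 2 ^ β) :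
    (sumTo R e).Does β s (N * 4 + 5)
      (fun s' => s.EqOff [4, 5] [] s' ∧ s'.var 5 = ∑ l, val l) := by
  rw [← sum_extend]
  refine does_sumTo N _ hN hR (fun l hl s' h h4 => ?_) fun j hj => bits_sum_extend_le hval hY hj
  rw [extend_of_lt _ hl]
  exact he ⟨l, hl⟩ s' h h4

theorem Filling.var {b : ℤ} {c : ℕ} {s' : Mem} (h : Filling a b s c s') {v : ℕ}
    (hv : v ∉ [3, 4, 5]) : s'.var v = s.var v := h.1.1 v hv

theorem Filling.arr {b : ℤ} {c : ℕ} {s' : Mem} (h : Filling a b s c s') {a' : ℕ}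
    (ha : a' ≠ a) : s'.arr a' = s.arr a' := h.1.2 a' (by simpa using ha)

theorem Filling.arr_self {b : ℤ} {c : ℕ} {s' : Mem} (h : Filling a b s c s') {x : ℤ}
    (hx : x < b ∨ b + c ≤ x) : s'.arr a x = s.arr a x := h.2 x fun y hy => by lia

theorem does_fill_vec (b : ℤ) {L N : ℕ} (val : Fin L → Fin N → ℤ) (out : Fin L → ℤ) (Y : ℤ)
    (hL : bits L ≤ β) (hN : bits N ≤ β)
    (hbase : ∀ s', s.EqOff [3, 4, 5] [a] s' → base.eval s' = b)
    (hlen : ∀ s', s.EqOff [3, 4, 5] [a] s' → len.eval s' = L)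
    (hR : ∀ s', s.EqOff [3, 4, 5] [a] s' → R.eval s' = N)
    (he : ∀ (c : Fin L) (l : Fin N) s', Filling a b s c s' → s'.var 3 = (c : ℕ) →
      s'.var 4 = (l : ℕ) → e.eval s' = val c l)
    (hval : ∀ c l, |val c l| ≤ Y) (hY : N * Y < 2 ^ β)
    (hf : ∀ (c : Fin L) s', Filling a b s c s' → s'.var 3 = (c : ℕ) →
      s'.var 5 = ∑ l, val c l → f.eval s' = out c)
    (hout : ∀ c, bits (out c) ≤ β) :
    (fill a base len R e f).Does β s (L * (N * 4 + 10) + 3)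
      (fun s' => Filling a b s L s' ∧ ∀ c : Fin L, s'.arr a (b + (c : ℕ)) = out c) := by
  refine (does_fill b L N (fun c l => if hc : c < L then extend (val ⟨c, hc⟩) l else 0)
    (extend out) hL hN hbase hlen hR ?_ ?_ ?_ ?_).imp ?_
  · intro c hc l hl s' h h3 h4
    rw [dif_pos hc, extend_of_lt _ hl]
    exact he ⟨c, hc⟩ ⟨l, hl⟩ s' h h3 h4
  · intro c hc j hj
    simp only [dif_pos hc]
    exact bits_sum_extend_le (hval ⟨c, hc⟩) hY hj
  · intro c hc s' h h3 h5
    simp only [dif_pos hc, sum_extend] at h5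
    rw [extend_of_lt _ hc]
    exact hf ⟨c, hc⟩ s' h h3 h5
  · intro c hc
    rw [extend_of_lt _ hc]
    exact hout _
  · rintro s' ⟨h1, h2⟩
    exact ⟨h1, fun c => by rw [h2 c c.isLt, extend_of_lt _ c.isLt]⟩

theorem does_fillMap_vec (b : ℤ) {L : ℕ} (out : Fin L → ℤ) (hL : bits L ≤ β)
    (hbase : ∀ s', s.EqOff [3, 4, 5] [a] s' → base.eval s' = b)
    (hlen : ∀ s', s.EqOff [3, 4, 5] [a] s' → len.eval s' = L)
    (hf : ∀ (c : Fin L) s', Filling a b s c s' → s'.var 3 = (c : ℕ) → f.eval s' = out c)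
    (hout : ∀ c, bits (out c) ≤ β) :
    (fillMap a base len f).Does β s (L * 10 + 3)
      (fun s' => Filling a b s L s' ∧ ∀ c : Fin L, s'.arr a (b + (c : ℕ)) = out c) :=
  (does_fill_vec b (N := 0) (fun _ => Fin.elim0) out 0 hL (by simp [bits]) hbase hlen
    (fun _ _ => rfl) (fun _ l => l.elim0) (fun _ l => l.elim0) (by simp)
    (fun c s' h h3 _ => hf c s' h h3) hout).mono (by lia) fun s' _ h => h

theorem cell_lt {p q : ℕ} (i : Fin p) (j : Fin q) : i.val * q + j.val < p * q :=
  calc i.val * q + j.val < i.val * q + q := by lia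
    _ = (i.val + 1) * q := by ring
    _ ≤ p * q := Nat.mul_le_mul_right _ i.isLt

theorem divNat_mul_add_modNat {p q : ℕ} (c : Fin (p * q)) :
    (c : ℕ) = c.divNat.val * q + c.modNat.val := by
  rw [Fin.coe_divNat, Fin.coe_modNat]
  exact (Nat.div_add_mod' _ _).symm

theorem cell_div {q : ℕ} (i : ℕ) (j : Fin q) : (i * q + j.val) / q = i := by
  rw [mul_comm, Nat.mul_add_div j.pos, Nat.div_eq_of_lt j.isLt, add_zero]

theorem cell_mod {q : ℕ} (i : ℕ) (j : Fin q) : (i * q + j.val) % q = j := by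
  rw [mul_comm, Nat.mul_add_mod, Nat.mod_eq_of_lt j.isLt]

theorem cell_injective {p q : ℕ} {i i' : Fin p} {j j' : Fin q}
    (h : (i : ℕ) * (q : ℤ) + (j : ℕ) = (i' : ℕ) * (q : ℤ) + (j' : ℕ)) : i = i' ∧ j = j' := by
  have h' : i.val * q + j.val = i'.val * q + j'.val := by exact_mod_cast h
  have h1 := congrArg (· / q) h'
  have h2 := congrArg (· % q) h'
  simp only [cell_div, cell_mod] at h1 h2
  exact ⟨Fin.ext h1, Fin.ext h2⟩

theorem does_fill_mat {p q N : ℕ} (val : Fin p → Fin q → Fin N → ℤ) (out : Fin p → Fin q → ℤ)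
    (Y : ℤ) (hL : bits (p * q : ℕ) ≤ β) (hN : bits N ≤ β)
    (hlen : ∀ s', s.EqOff [3, 4, 5] [a] s' → len.eval s' = p * q)
    (hR : ∀ s', s.EqOff [3, 4, 5] [a] s' → R.eval s' = N)
    (he : ∀ (i : Fin p) (j : Fin q) (l : Fin N) s', s.EqOff [3, 4, 5] [a] s' →
      s'.var 3 / q = (i : ℕ) → s'.var 3 % q = (j : ℕ) → s'.var 4 = (l : ℕ) →
      e.eval s' = val i j l)
    (hval : ∀ i j l, |val i j l| ≤ Y) (hY : N * Y < 2 ^ β)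
    (hf : ∀ (i : Fin p) (j : Fin q) s', s.EqOff [3, 4, 5] [a] s' → s'.var 3 = (i : ℕ) * q + (j : ℕ) →
      s'.var 3 / q = (i : ℕ) → s'.var 3 % q = (j : ℕ) →
      s'.var 5 = ∑ l, val i j l → f.eval s' = out i j)
    (hout : ∀ i j, bits (out i j) ≤ β) :
    (fill a (.const 0) len R e f).Does β s (p * q * (N * 4 + 10) + 3)
      (fun s' => Filling a 0 s (p * q) s' ∧ ∀ (i : Fin p) (j : Fin q), s'.arr a ((i : ℕ) * q + (j : ℕ)) = out i j) := by
  have hd : ∀ (c : Fin (p * q)) (s' : Mem), s'.var 3 = (c : ℕ) →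
      s'.var 3 / q = (c.divNat : ℕ) ∧ s'.var 3 % q = (c.modNat : ℕ) := by
    intro c s' h
    rw [h, Fin.coe_divNat, Fin.coe_modNat]
    norm_cast
  refine (does_fill_vec 0 (L := p * q) (fun c => val c.divNat c.modNat)
    (fun c => out c.divNat c.modNat) Y hL hN (fun _ _ => rfl)
    (fun s' h => by rw [hlen s' h]; norm_cast) hR ?_ (fun c => hval _ _) hY ?_
    (fun c => hout _ _)).imp ?_
  · intro c l s' h h3 h4
    exact he _ _ l s' h.1 (hd c s' h3).1 (hd c s' h3).2 h4
  · intro c s' h h3 h5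
    refine hf _ _ s' h.1 ?_ (hd c s' h3).1 (hd c s' h3).2 h5
    rw [h3]
    exact_mod_cast divNat_mul_add_modNat c
  · rintro s' ⟨h1, h2⟩
    refine ⟨h1, fun i j => ?_⟩
    have := h2 ⟨i.val * q + j.val, cell_lt i j⟩
    have e1 : Fin.divNat (⟨i.val * q + j.val, cell_lt i j⟩ : Fin (p * q)) = i :=
      Fin.ext (cell_div i.val j)
    have e2 : Fin.modNat (⟨i.val * q + j.val, cell_lt i j⟩ : Fin (p * q)) = j :=
      Fin.ext (cell_mod i.val j)
    rw [e1, e2] at this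
    rw [← this]
    push_cast
    rw [zero_add]

theorem does_fillMap_mat {p q : ℕ} (out : Fin p → Fin q → ℤ) (hL : bits (p * q : ℕ) ≤ β)
    (hlen : ∀ s', s.EqOff [3, 4, 5] [a] s' → len.eval s' = p * q)
    (hf : ∀ (i : Fin p) (j : Fin q) s', s.EqOff [3, 4, 5] [a] s' → s'.var 3 = (i : ℕ) * q + (j : ℕ) →
      s'.var 3 / q = (i : ℕ) → s'.var 3 % q = (j : ℕ) → f.eval s' = out i j)
    (hout : ∀ i j, bits (out i j) ≤ β) :
    (fillMap a (.const 0) len f).Does β s (p * q * 10 + 3)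
      (fun s' => Filling a 0 s (p * q) s' ∧ ∀ (i : Fin p) (j : Fin q), s'.arr a ((i : ℕ) * q + (j : ℕ)) = out i j) :=
  (does_fill_mat (N := 0) (fun _ _ => Fin.elim0) out 0 hL (by simp [bits]) hlen
    (fun _ _ => rfl) (fun _ _ l => l.elim0) (fun _ _ l => l.elim0) (by simp)
    (fun i j s' h h3 hdiv hmod _ => hf i j s' h h3 hdiv hmod) hout).mono (by lia) fun s' _ h => h

end BitRAM

namespace BitRAM

/-! ### The Faddeev–LeVerrier recursion as a program

Variable `1` holds the number of rows, variable `2` the number of columns. -/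

/-- The entry in row `i` and column `j` of the input matrix. -/
def entry (i j : Expr) : Expr := .read 0 (.const 2 + i * .var 2 + j)

/-- The entry in row `i` of the right hand side. -/
def rhs (i : Expr) : Expr := .read 0 (.const 2 + .var 1 * .var 2 + i)

/-- The memory holds the given system. -/
structure Loaded {m k : ℕ} (B : Matrix (Fin m) (Fin m) ℤ) (N : Matrix (Fin m) (Fin k) ℤ)
    (b : Fin m → ℤ) (s : Mem) : Prop where
  rows : s.var 1 = m
  cols : s.var 2 = m + k
  left : ∀ i j : Fin m, s.arr 0 (2 + (i : ℕ) * ((m : ℤ) + k) + (j : ℕ)) = B i j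
  right : ∀ (i : Fin m) (j : Fin k), s.arr 0 (2 + (i : ℕ) * ((m : ℤ) + k) + (m + (j : ℕ))) = N i j
  rhs : ∀ i : Fin m, s.arr 0 (2 + m * ((m : ℤ) + k) + (i : ℕ)) = b i

variable {m k : ℕ} {B : Matrix (Fin m) (Fin m) ℤ} {N : Matrix (Fin m) (Fin k) ℤ} {b : Fin m → ℤ}

theorem Loaded.eqOff {s s' : Mem} (h : Loaded B N b s) {vs as : List ℕ} (h' : s.EqOff vs as s')
    (h1 : 1 ∉ vs) (h2 : 2 ∉ vs) (h0 : 0 ∉ as) : Loaded B N b s' where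
  rows := by rw [h'.1 1 h1, h.rows]
  cols := by rw [h'.1 2 h2, h.cols]
  left := by rw [h'.2 0 h0]; exact h.left
  right := by rw [h'.2 0 h0]; exact h.right
  rhs := by rw [h'.2 0 h0]; exact h.rhs

/-- Array `a` holds the matrix `M`, row by row. -/
def HoldsMat (s : Mem) (a : ℕ) {p q : ℕ} (M : Fin p → Fin q → ℤ) : Prop :=
  ∀ (i : Fin p) (j : Fin q), s.arr a ((i : ℕ) * (q : ℤ) + (j : ℕ)) = M i j

/-- Array `a` holds the vector `v`. -/
def HoldsVec (s : Mem) (a : ℕ) {p : ℕ} (v : Fin p → ℤ) : Prop :=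
  ∀ i : Fin p, s.arr a (i : ℕ) = v i

/-- One step of the recursion. -/
def faddeevStep : Prog :=
  .seq (fillMap 2 (.const 0) (.var 1 * .var 1)
    (.read 3 (.var 3) + .var 7 * (.var 3 / .var 1 - (Expr.var 3).mod (.var 1)).isZero))
  (.seq (fill 3 (.const 0) (.var 1 * .var 1) (.var 1)
    (entry (.var 3 / .var 1) (.var 4) *
      .read 2 (.var 4 * .var 1 + (Expr.var 3).mod (.var 1))) (.var 5))
  (.seq (sumTo (.var 1) (.read 3 (.var 4 * .var 1 + .var 4)))
    (.assign 7 ((.const 0 - .var 5) / (.var 6 + .const 1)))))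

/-- Array `2` and variable `7` become a matrix `M` and a number `d` with `B * M = d • 1`. -/
def faddeev : Prog :=
  .seq (.assign 7 (.const 1))
    (.seq (forLoop 6 (.var 1) faddeevStep) (.assign 7 (.const 0 - .var 7)))

/-- The loop invariant of `faddeev`. -/
structure FaddeevInv (B : Matrix (Fin m) (Fin m) ℤ) (s : Mem) (t : ℕ) (s' : Mem) : Prop where
  eqOff : s.EqOff [3, 4, 5, 6, 7] [2, 3] s'
  mat : HoldsMat s' 2 (B.flMat t)
  prod : HoldsMat s' 3 (B * B.flMat t)
  coeff : s'.var 7 = B.flCoeff t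
  outside : ∀ x : ℤ, m * m ≤ x → s'.arr 2 x = 0

theorem does_faddeevStep {s s' : Mem} {β t : ℕ} {α X : ℤ} (hs : Loaded B N b s)
    (hmm : bits (m * m : ℕ) ≤ β) (hX : m * (α * X) < 2 ^ β) (hα : 1 ≤ α)
    (hB : ∀ i j, |B i j| ≤ α)
    (hM : ∀ t ≤ m, (∀ i j, |B.flMat t i j| ≤ X) ∧ (∀ i j, |(B * B.flMat t) i j| ≤ X) ∧
      |B.flCoeff t| ≤ X)
    (ht : t < m) (h : FaddeevInv B s t s') (h6 : s'.var 6 = t) :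
    faddeevStep.Does β s' (m * m * (m * 4 + 30) + 30)
      (fun s'' => s''.var 6 = t ∧ FaddeevInv B s (t + 1) (s''.assign 6 (t + 1))) := by
  have hL : Loaded B N b s' := hs.eqOff h.eqOff (by simp) (by simp) (by simp)
  have hm1 : (1 : ℤ) ≤ m := by lia
  have hbm : bits m ≤ β := bits_natCast_le (Nat.le_mul_self m) hmm
  have hX0 : 0 ≤ X := (abs_nonneg _).trans (hM t ht.le).2.2
  have hXα : X ≤ α * X := le_mul_of_one_le_left hX0 hα
  have hXm : X ≤ m * (α * X) := hXα.trans (le_mul_of_one_le_left (hX0.trans hXα) hm1)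
  have hXβ : X < 2 ^ β := hXm.trans_lt hX
  refine ((does_fillMap_mat (p := m) (q := m) (B.flMat (t + 1)) hmm ?_ ?_ ?_).seq
    (n' := m * m * (m * 4 + 10) + 3 + (m * 4 + 5 + 1 + 1) + 1) ?_).mono ?_ fun _ _ h => h
  · intro s₁ h1
    simp [h1.1, hL.rows]
  · intro i j s₁ h1 h3 hdiv hmod
    simp only [Expr.eval_add, Expr.eval_read, Expr.eval_mul, Expr.eval_var, Expr.eval_isZero,
      Expr.eval_sub, Expr.eval_div, Expr.eval_mod, h1.1 1 (by simp), h1.1 7 (by simp), hL.rows,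
      h1.2 3 (by simp), hdiv, hmod, h.coeff]
    rw [h3, h.prod i j, B.flMat_succ ht, Matrix.add_apply, Matrix.smul_apply, Matrix.one_apply,
      smul_eq_mul]
    simp only [sub_eq_zero, Nat.cast_inj, Fin.ext_iff]
  · exact fun i j => bits_le_of_abs_le ((hM (t + 1) ht).1 i j) hXβ
  swap
  · have : 1 ≤ m := by lia
    nlinarith [Nat.mul_le_mul_left m this]
  rintro s₁ ⟨h1, hmat⟩
  have hM1 : HoldsMat s₁ 2 (B.flMat (t + 1)) := hmat
  refine (does_fill_mat (p := m) (q := m) (N := m) (fun i j l => B i l * B.flMat (t + 1) l j)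
    (B * B.flMat (t + 1)) (α * X) hmm hbm ?_ ?_ ?_ ?_ hX ?_ ?_).seq ?_
  · intro s₂ h2
    simp [h2.1, h1.1.1, hL.rows]
  · intro s₂ h2
    simp [h2.1, h1.1.1, hL.rows]
  · intro i j l s₂ h2 hdiv hmod h4
    simp only [entry, Expr.eval_add, Expr.eval_read, Expr.eval_mul, Expr.eval_var, Expr.eval_const,
      Expr.eval_div, Expr.eval_mod, h2.1 1 (by simp), h2.1 2 (by simp), h2.2 0 (by simp),
      h2.2 2 (by simp), h1.var (v := 1) (by simp), h1.var (v := 2) (by simp),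
      h1.arr (a' := 0) (by simp), hL.rows, hL.cols, hdiv, hmod, h4]
    rw [hL.left, hM1]
  · intro i j l
    rw [abs_mul]
    exact mul_le_mul (hB i l) ((hM (t + 1) ht).1 l j) (abs_nonneg _) (by lia)
  · intro i j s₂ h2 h3 hdiv hmod h5
    rw [Expr.eval_var, h5, Matrix.mul_apply]
  · exact fun i j => bits_le_of_abs_le ((hM (t + 1) ht).2.1 i j) hXβ
  rintro s₂ ⟨h2, hprod⟩
  have hP2 : HoldsMat s₂ 3 (B * B.flMat (t + 1)) := hprod
  refine Prog.Does.seq (n := m * 4 + 5) (n' := 1) (does_sumTo_fin (N := m)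
    (fun l => (B * B.flMat (t + 1)) l l) X hbm ?_ ?_ ?_ ?_) ?_
  · intro s₃ h3
    simp [h3.1, h2.1.1, h1.1.1, hL.rows]
  · intro l s₃ h3 h4
    simp only [Expr.eval_add, Expr.eval_read, Expr.eval_mul, Expr.eval_var, h3.1 1 (by simp),
      h3.2 3 (by simp), h2.var (v := 1) (by simp), h1.var (v := 1) (by simp), hL.rows, h4]
    exact hP2 l l
  · exact fun l => (hM (t + 1) ht).2.1 l l
  · exact (mul_le_mul_of_nonneg_left hXα (by lia)).trans_lt hX
  rintro s₃ ⟨h3, h5⟩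
  have hval : ((Expr.const 0 - .var 5) / (.var 6 + .const 1)).eval s₃ = B.flCoeff (t + 1) := by
    simp only [Expr.eval_div, Expr.eval_sub, Expr.eval_const, Expr.eval_var, Expr.eval_add,
      h3.1 6 (by simp), h2.var (v := 6) (by simp), h1.var (v := 6) (by simp), h6, h5]
    rw [B.flCoeff_succ ht]
    rfl
  refine Prog.does_assign (by rw [hval]; exact bits_le_of_abs_le (hM (t + 1) ht).2.2 hXβ) ?_
  rw [hval]
  refine ⟨?_, ?_, ?_, ?_, by simp, ?_⟩
  · simp [h3.1, h2.1.1, h1.1.1, h6]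
  · refine Mem.EqOff.assign (Mem.EqOff.assign ?_ (by simp) _) (by simp) _
    exact (((h.eqOff.trans h1.1).trans h2.1).trans h3).mono (by simp) (by simp)
  · intro i j
    rw [Mem.assign_arr, Mem.assign_arr, h3.2 2 (by simp), h2.arr (by simp)]
    exact hM1 i j
  · intro i j
    rw [Mem.assign_arr, Mem.assign_arr, h3.2 3 (by simp)]
    exact hP2 i j
  · intro x hx
    rw [Mem.assign_arr, Mem.assign_arr, h3.2 2 (by simp), h2.arr (by simp),
      h1.arr_self (by right; push_cast; lia)]
    exact h.outside x hx

theorem does_faddeev {s : Mem} {β : ℕ} {α X : ℤ} (hs : Loaded B N b s) (hm : 0 < m)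
    (h2 : ∀ x, s.arr 2 x = 0) (h3 : ∀ x, s.arr 3 x = 0)
    (hmm : bits (m * m : ℕ) ≤ β) (hX : m * (α * X) < 2 ^ β) (hα : 1 ≤ α)
    (hB : ∀ i j, |B i j| ≤ α)
    (hM : ∀ t ≤ m, (∀ i j, |B.flMat t i j| ≤ X) ∧ (∀ i j, |(B * B.flMat t) i j| ≤ X) ∧
      |B.flCoeff t| ≤ X) :
    faddeev.Does β s (m * (m * m * (m * 4 + 30) + 33) + 10)
      (fun s' => s.EqOff [3, 4, 5, 6, 7] [2, 3] s' ∧ HoldsMat s' 2 (B.flMat m) ∧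
        (∀ x : ℤ, m * m ≤ x → s'.arr 2 x = 0) ∧ s'.var 7 = -B.flCoeff m) := by
  have hm1 : (1 : ℤ) ≤ m := by lia
  have hX0 : 0 ≤ X := (abs_nonneg _).trans (hM 0 hm.le).2.2
  have hXα : X ≤ α * X := le_mul_of_one_le_left hX0 hα
  have hXβ : X < 2 ^ β := (hXα.trans (le_mul_of_one_le_left (hX0.trans hXα) hm1)).trans_lt hX
  have h1β : bits 1 ≤ β := bits_natCast_le (N := 1) (Nat.mul_pos hm hm) hmm
  refine ((Prog.does_assign (Q := FaddeevInv B s 0) h1β ?_).seq (n' := m * (m * m * (m * 4 + 30) +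
    33) + 5) ?_).mono (by lia) fun _ _ h => h
  · refine ⟨(Mem.EqOff.refl _ _ s).assign (by simp) _, fun i j => ?_, fun i j => ?_, ?_,
      fun x _ => h2 x⟩
    · simp [h2, B.flMat_zero]
    · simp [h3, B.flMat_zero]
    · simp [B.flCoeff_zero]
  intro s₁ h1
  refine (Prog.Does.seq (n := m * (m * m * (m * 4 + 30) + 33) + 3) (n' := 1)
    (does_forLoop (N := m) (FaddeevInv B s)
    (bits_natCast_le (Nat.le_mul_self m) hmm) ?_ ?_ ?_) ?_).mono (by lia) fun _ _ h => h
  · exact ⟨h1.eqOff.assign (by simp) _, h1.mat, h1.prod, by simp [h1.coeff], h1.outside⟩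
  · intro j _ s₂ h _
    simp [h.eqOff.1, hs.rows]
  · intro t ht s₂ _ h h6
    exact does_faddeevStep hs hmm hX hα hB hM ht h h6
  intro s₂ h
  have hval : (Expr.const 0 - .var 7).eval s₂ = -B.flCoeff m := by simp [h.coeff]
  refine Prog.does_assign (by rw [hval]; exact bits_le_of_abs_le (by
    rw [abs_neg]; exact (hM m le_rfl).2.2) hXβ) ?_
  rw [hval]
  exact ⟨h.eqOff.assign (by simp) _, h.mat, h.outside, by simp⟩

end BitRAM

namespace BitRAM

open Lattice

/-! ### Insertion into a triangular basis as a program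

Array `6` holds the triangular basis, array `5` the vector, variable `7` the modulus. -/

/-- One Euclidean step on row `9` of the basis and the vector. -/
def elimStep : Prog :=
  .seq (.assign 10 (.read 6 (.var 9 * .var 2 + .var 9) / .read 5 (.var 9)))
  (.seq (fillMap 11 (.const 0) (.var 2) (.read 5 (.var 3)))
  (.seq (fillMap 5 (.const 0) (.var 2)
    (Expr.mod (.read 6 (.var 9 * .var 2 + .var 3) - .var 10 * .read 5 (.var 3)) (.var 7)))
  (fillMap 6 (.var 9 * .var 2) (.var 2) (.read 11 (.var 3)))))

/-- Insert the vector into the basis. -/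
def eliminate : Prog := forLoop 9 (.var 2) (.loop (.read 5 (.var 9)) elimStep)

section

variable {n : ℕ} {d : ℤ} {β : ℕ} {s : Mem}

theorem does_elimStep {T : Fin n → Fin n → ℤ} {L : Submodule ℤ (Fin n → ℤ)} {v : Fin n → ℤ}
    {i : Fin n} (hd : d ≠ 0) (hdβ : |d| < 2 ^ β) (hn : bits n ≤ β)
    (h2 : s.var 2 = n) (h7 : s.var 7 = d) (h9 : s.var 9 = (i : ℕ))
    (hT : HoldsMat s 6 T) (hv : HoldsVec s 5 v) (h : Inserting d T L v i) :
    elimStep.Does β s (n * 30 + 13) (fun s' => s.EqOff [3, 4, 5, 10] [5, 6, 11] s' ∧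
      HoldsMat s' 6 (Function.update T i v) ∧
      HoldsVec s' 5 fun b => (T i b - T i i / v i * v b) % d) := by
  have hval : (Expr.read 6 (.var 9 * .var 2 + .var 9) / .read 5 (.var 9)).eval s =
      T i i / v i := by
    simp only [Expr.eval_div, Expr.eval_read, Expr.eval_add, Expr.eval_mul, Expr.eval_var, h2, h9]
    rw [hT i i, hv i]
  refine (Prog.Does.seq (n := 1) (n' := n * 10 + 3 + (n * 10 + 3 + (n * 10 + 3) + 1) + 1)
    (Prog.does_assign
    (Q := fun s' => s.EqOff [10] [] s' ∧ s'.var 10 = T i i / v i) ?_ ?_) ?_).mono (by lia)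
    fun _ _ h => h
  · rw [hval]
    exact bits_le_of_abs_le ((Int.abs_ediv_le_abs _ _).trans (h.bound i i)) hdβ
  · exact ⟨(Mem.EqOff.refl _ _ s).assign (by simp) _, by rw [hval]; simp⟩
  rintro s₁ ⟨e1, h10⟩
  have hvb : ∀ c, bits (v c) ≤ β := fun c => bits_le_of_abs_le
    (by rw [abs_of_nonneg (h.rem c).1]; exact (h.rem c).2.le) hdβ
  refine Prog.Does.seq (n := n * 10 + 3) (n' := n * 10 + 3 + (n * 10 + 3) + 1)
    (does_fillMap_vec 0 v hn (fun _ _ => rfl) ?_ ?_ hvb) ?_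
  · intro s' h'
    simp [h'.1, e1.1, h2]
  · intro c s' h' h3
    simp only [Expr.eval_read, Expr.eval_var, h3, h'.arr (a' := 5) (by simp), e1.2 5 (by simp)]
    exact hv c
  rintro s₂ ⟨e2, hcopy⟩
  refine Prog.Does.seq (n := n * 10 + 3) (n' := n * 10 + 3)
    (does_fillMap_vec 0 (fun b => (T i b - T i i / v i * v b) % d) hn (fun _ _ => rfl)
      ?_ ?_ ?_) ?_
  · intro s' h'
    simp [h'.1, e2.1.1, e1.1, h2]
  · intro c s' h' h3
    simp only [Expr.eval_mod, Expr.eval_sub, Expr.eval_mul, Expr.eval_add, Expr.eval_read,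
      Expr.eval_var, h3, h'.var (v := 2) (by simp), h'.var (v := 7) (by simp),
      h'.var (v := 9) (by simp), h'.var (v := 10) (by simp), h'.arr (a' := 6) (by simp),
      h'.arr_self (x := ((c : ℕ) : ℤ)) (by right; lia),
      e2.var (v := 2) (by simp), e2.var (v := 7) (by simp),
      e2.var (v := 9) (by simp), e2.var (v := 10) (by simp), e2.arr (a' := 6) (by simp),
      e2.arr (a' := 5) (by simp), e1.1 2 (by simp), e1.1 7 (by simp), e1.1 9 (by simp),
      e1.2 6 (by simp), e1.2 5 (by simp), h10, h2, h7, h9]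
    rw [hT i c, hv c]
  · intro c
    exact bits_le_of_abs_le (by
      rw [abs_of_nonneg (Int.emod_nonneg _ hd)]; exact (Int.emod_lt_abs _ hd).le) hdβ
  rintro s₃ ⟨e3, hnew⟩
  refine (does_fillMap_vec ((i : ℕ) * (n : ℤ)) v hn ?_ ?_ ?_ hvb).imp ?_
  · intro s' h'
    simp [h'.1, e3.1.1, e2.1.1, e1.1, h2, h9]
  · intro s' h'
    simp [h'.1, e3.1.1, e2.1.1, e1.1, h2]
  · intro c s' h' h3
    simp only [Expr.eval_read, Expr.eval_var, h3, h'.arr (a' := 11) (by simp),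
      e3.arr (a' := 11) (by simp)]
    simpa using hcopy c
  rintro s₄ ⟨e4, hrow⟩
  refine ⟨(((e1.trans e2.1).trans e3.1).trans e4.1).mono (by simp) (by simp), ?_, ?_⟩
  · intro a c
    by_cases ha : a = i
    · subst ha
      rw [hrow c, Function.update_self]
    · rw [Function.update_of_ne ha, e4.2, e3.arr (by simp), e2.arr (by simp), e1.2 6 (by simp)]
      · exact hT a c
      · intro y hy heq
        exact ha (cell_injective (i' := i) (j' := (⟨y, hy⟩ : Fin n)) heq).1
  · intro c
    rw [e4.arr (by simp)]
    simpa using hnew c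

/-- Euclid's algorithm on `x, y` takes at most the given number of steps. -/
def EuclidBound : ℕ → ℤ → ℤ → Prop
  | 0, _, y => y ≤ 0
  | r + 1, x, y => y ≤ 0 ∨ EuclidBound r y (x % y)

theorem EuclidBound.of_nonpos {r : ℕ} {x y : ℤ} (h : y ≤ 0) : EuclidBound r x y := by
  cases r with
  | zero => exact h
  | succ r => exact Or.inl h

theorem euclidBound_of_lt {r : ℕ} {x y : ℤ} (h : y < 2 ^ r) : EuclidBound (2 * r) x y := by
  induction r generalizing x y with
  | zero => rw [pow_zero] at h; exact EuclidBound.of_nonpos (by lia)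
  | succ r ih =>
    by_cases hy : 0 < y
    · refine Or.inr ?_
      by_cases hr : 0 < x % y
      · refine Or.inr (ih ?_)
        have := emod_emod_lt_half hy hr
        rw [pow_succ] at h
        lia
      · exact EuclidBound.of_nonpos (by lia)
    · exact EuclidBound.of_nonpos (by lia)

/-- The bound on the number of steps of `eliminate`. -/
def eliminateSteps (n β : ℕ) : ℕ := n * (2 * β * (n * 30 + 14) + 1 + 3) + 3

theorem does_eliminate {T : Fin n → Fin n → ℤ} {L : Submodule ℤ (Fin n → ℤ)} {v : Fin n → ℤ}
    (hd : d ≠ 0) (hdβ : |d| < 2 ^ β) (hn : bits n ≤ β)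
    (h2 : s.var 2 = n) (h7 : s.var 7 = d) (hT : HoldsMat s 6 T) (hv : HoldsVec s 5 v)
    (h : Inserting d T L v 0) :
    eliminate.Does β s (eliminateSteps n β)
      (fun s' => s.EqOff [3, 4, 5, 9, 10] [5, 6, 11] s' ∧
        ∃ T', HoldsMat s' 6 T' ∧ IsTriBasis d T' L) := by
  refine (does_forLoop (n := 2 * β * (n * 30 + 14) + 1) (N := n)
    (fun i s' => s.EqOff [3, 4, 5, 9, 10] [5, 6, 11] s' ∧
      ∃ T v, HoldsMat s' 6 T ∧ HoldsVec s' 5 v ∧ Inserting d T L v i) hn ?_ ?_ ?_).imp ?_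
  · exact ⟨(Mem.EqOff.refl _ _ s).assign (by simp) _, T, v, hT, hv, h⟩
  · intro j _ s' h' _
    simp [h'.1.1, h2]
  · rintro j hj s₁ - ⟨e1, T₁, v₁, hT₁, hv₁, h₁⟩ h9
    refine (Prog.does_loop (n := n * 30 + 13) (N := 2 * β)
      (fun r s' => s₁.EqOff [3, 4, 5, 10] [5, 6, 11] s' ∧
        ∃ T v, HoldsMat s' 6 T ∧ HoldsVec s' 5 v ∧ Inserting d T L v j ∧
          EuclidBound r (T ⟨j, hj⟩ ⟨j, hj⟩) (v ⟨j, hj⟩)) ?_ ?_ ?_).mono le_rfl ?_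
    · rintro s₂ ⟨e2, T₂, v₂, hT₂, hv₂, h₂, hE⟩
      have := hv₂ ⟨j, hj⟩
      simp only [Expr.eval_read, Expr.eval_var, e2.1 9 (by simp), h9, this]
      exact not_lt.2 hE
    · rintro r s₂ - ⟨e2, T₂, v₂, hT₂, hv₂, h₂, hE⟩ hpos
      simp only [Expr.eval_read, Expr.eval_var, e2.1 9 (by simp), h9] at hpos
      rw [hv₂ ⟨j, hj⟩] at hpos
      refine (does_elimStep (i := ⟨j, hj⟩) hd hdβ hn ?_ ?_ ?_ hT₂ hv₂ h₂).imp ?_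
      · rw [e2.1 2 (by simp), e1.1 2 (by simp), h2]
      · rw [e2.1 7 (by simp), e1.1 7 (by simp), h7]
      · rw [e2.1 9 (by simp), h9]
      rintro s₃ ⟨e3, hT₃, hv₃⟩
      have hstep := h₂.step (i := ⟨j, hj⟩) hd hpos
      refine ⟨r, le_rfl, (e2.trans e3).mono (by simp) (by simp), _, _, hT₃, hv₃, hstep, ?_⟩
      rw [Function.update_self]
      have hlt := (Int.emod_lt_of_pos (T₂ ⟨j, hj⟩ ⟨j, hj⟩) hpos).trans (h₂.rem ⟨j, hj⟩).2
      have heq : (T₂ ⟨j, hj⟩ ⟨j, hj⟩ - T₂ ⟨j, hj⟩ ⟨j, hj⟩ / v₂ ⟨j, hj⟩ * v₂ ⟨j, hj⟩) % d =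
          T₂ ⟨j, hj⟩ ⟨j, hj⟩ % v₂ ⟨j, hj⟩ := by
        rw [mul_comm, ← Int.emod_def, ← Int.emod_abs]
        exact Int.emod_eq_of_lt (Int.emod_nonneg _ hpos.ne') hlt
      rw [heq]
      exact hE.resolve_left (not_le.2 hpos)
    · exact ⟨Mem.EqOff.refl _ _ _, T₁, v₁, hT₁, hv₁, h₁,
        euclidBound_of_lt ((h₁.rem _).2.trans hdβ)⟩
    · rintro s₂ - ⟨⟨r, e2, T₂, v₂, hT₂, hv₂, h₂, -⟩, hdone⟩
      simp only [Expr.eval_read, Expr.eval_var, e2.1 9 (by simp), h9] at hdone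
      rw [hv₂ ⟨j, hj⟩] at hdone
      have h0 : v₂ ⟨j, hj⟩ = 0 := le_antisymm (not_lt.1 hdone) (h₂.rem _).1
      refine ⟨by rw [e2.1 9 (by simp), h9], ?_, T₂, v₂, hT₂, hv₂, h₂.next (i := ⟨j, hj⟩) h0⟩
      exact ((e1.trans e2).mono (by simp) (by simp)).assign (by simp) _
  · rintro s' ⟨e, T', v', hT', -, h'⟩
    exact ⟨e, T', hT', h'.finish⟩

/-- Reduce the vector modulo the basis. -/
def reduce : Prog :=
  forLoop 9 (.var 2)
    (.seq (.assign 10 (.read 5 (.var 9) / .read 6 (.var 9 * .var 2 + .var 9)))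
      (fillMap 5 (.const 0) (.var 2)
        (Expr.mod (.read 5 (.var 3) - .var 10 * .read 6 (.var 9 * .var 2 + .var 3)) (.var 7))))

theorem does_reduce {T : Fin n → Fin n → ℤ} {L : Submodule ℤ (Fin n → ℤ)} {v : Fin n → ℤ}
    (hd : d ≠ 0) (hdβ : |d| < 2 ^ β) (hn : bits n ≤ β)
    (h2 : s.var 2 = n) (h7 : s.var 7 = d) (hT : HoldsMat s 6 T) (hv : HoldsVec s 5 v)
    (h : IsTriBasis d T L) (hrem : IsRem d v) :
    reduce.Does β s (n * (n * 10 + 8) + 3)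
      (fun s' => s.EqOff [3, 4, 5, 9, 10] [5] s' ∧
        ∃ v', HoldsVec s' 5 v' ∧ IsRem d v' ∧ IsReduced T v' n ∧ v - v' ∈ L) := by
  refine (does_forLoop (n := n * 10 + 5) (N := n)
    (fun i s' => s.EqOff [3, 4, 5, 9, 10] [5] s' ∧
      ∃ v', HoldsVec s' 5 v' ∧ IsRem d v' ∧ IsReduced T v' i ∧ v - v' ∈ L) hn ?_ ?_ ?_).imp ?_
  · exact ⟨(Mem.EqOff.refl _ _ s).assign (by simp) _, v, hv, hrem,
      fun b hb => absurd hb (by lia), by simp⟩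
  · intro j _ s' h' _
    simp [h'.1.1, h2]
  · rintro j hj s₁ - ⟨e1, w, hw, hwrem, hwred, hwL⟩ h9
    obtain ⟨i, rfl⟩ : ∃ i : Fin n, j = i := ⟨⟨j, hj⟩, rfl⟩
    have hval : (Expr.read 5 (.var 9) / .read 6 (.var 9 * .var 2 + .var 9)).eval s₁ =
        w i / T i i := by
      simp only [Expr.eval_div, Expr.eval_read, Expr.eval_add, Expr.eval_mul, Expr.eval_var,
        e1.1 2 (by simp), e1.2 6 (by simp), h2, h9]
      rw [hT i i, hw i]
    refine (Prog.Does.seq (n := 1) (n' := n * 10 + 3)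
      (Prog.does_assign (Q := fun s' => s₁.EqOff [10] [] s' ∧ s'.var 10 = w i / T i i) ?_ ?_)
      ?_).mono (by lia) fun _ _ h => h
    · rw [hval]
      refine bits_le_of_abs_le (Int.abs_ediv_le_abs _ _) (lt_of_le_of_lt ?_ hdβ)
      rw [abs_of_nonneg (hwrem i).1]
      exact (hwrem i).2.le
    · exact ⟨(Mem.EqOff.refl _ _ _).assign (by simp) _, by rw [hval]; simp⟩
    rintro s₂ ⟨e2, h10⟩
    refine (does_fillMap_vec 0 (fun b => (w b - w i / T i i * T i b) % d) hn (fun _ _ => rfl)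
      ?_ ?_ ?_).imp ?_
    · intro s' h'
      simp [h'.1, e2.1, e1.1, h2]
    · intro c s' h' h3
      simp only [Expr.eval_mod, Expr.eval_sub, Expr.eval_mul, Expr.eval_add, Expr.eval_read,
        Expr.eval_var, h3, h'.var (v := 2) (by simp), h'.var (v := 7) (by simp),
        h'.var (v := 9) (by simp), h'.var (v := 10) (by simp), h'.arr (a' := 6) (by simp),
        h'.arr_self (x := ((c : ℕ) : ℤ)) (by right; lia),
        e2.1 2 (by simp), e2.1 7 (by simp), e2.1 9 (by simp),
        e2.2 6 (by simp), e2.2 5 (by simp), e1.1 2 (by simp), e1.1 7 (by simp),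
        e1.2 6 (by simp), h10, h2, h7, h9]
      rw [hT i c, hw c]
    · intro c
      exact bits_le_of_abs_le (by
        rw [abs_of_nonneg (Int.emod_nonneg _ hd)]; exact (Int.emod_lt_abs _ hd).le) hdβ
    rintro s₃ ⟨e3, hnew⟩
    obtain ⟨k1, k2⟩ := h.reduce hwrem hwred
    refine ⟨?_, ?_, _, fun c => ?_, isRem_mod hd _, k1, ?_⟩
    · rw [e3.var (by simp), e2.1 9 (by simp), h9]
    · exact (((e1.trans e2).trans e3.1).mono (by simp) (by simp)).assign (by simp) _
    · simpa using hnew c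
    · have := add_mem hwL k2
      rwa [sub_add_sub_cancel] at this
  · exact fun s' h => h

end

end BitRAM

namespace BitRAM

open Lattice

variable {m k : ℕ} {B : Matrix (Fin m) (Fin m) ℤ} {N : Matrix (Fin m) (Fin k) ℤ} {b : Fin m → ℤ}

/-- The memory holds the system, a matrix `M` in array `2` and a modulus `d` in variable `7`. -/
structure Prepared (B : Matrix (Fin m) (Fin m) ℤ) (N : Matrix (Fin m) (Fin k) ℤ)
    (b : Fin m → ℤ) (M : Matrix (Fin m) (Fin m) ℤ) (d : ℤ) (s : Mem) : Prop
    extends Loaded B N b s where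
  mat : HoldsMat s 2 M
  outside : ∀ x : ℤ, m * m ≤ x → s.arr 2 x = 0
  modulus : s.var 7 = d

variable {M : Matrix (Fin m) (Fin m) ℤ} {d : ℤ}

theorem Prepared.eqOff {s s' : Mem} (h : Prepared B N b M d s) {vs as : List ℕ}
    (h' : s.EqOff vs as s') (hv : ∀ v ∈ [1, 2, 7], v ∉ vs) (ha : ∀ a ∈ [0, 2], a ∉ as) :
    Prepared B N b M d s' where
  toLoaded := h.toLoaded.eqOff h' (hv 1 (by simp)) (hv 2 (by simp)) (ha 0 (by simp))
  mat := by unfold HoldsMat; rw [h'.2 2 (ha 2 (by simp))]; exact h.mat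
  outside := by rw [h'.2 2 (ha 2 (by simp))]; exact h.outside
  modulus := by rw [h'.1 7 (hv 7 (by simp)), h.modulus]

/-- The matrix `M`, extended by zero rows. -/
def extendRows (k : ℕ) (M : Matrix (Fin m) (Fin m) ℤ) (c : Fin (m + k)) (l : Fin m) : ℤ :=
  Fin.addCases (fun i => M i l) (fun _ => 0) c

theorem Prepared.read_mat {s : Mem} (h : Prepared B N b M d s) (c : Fin (m + k)) (l : Fin m) :
    s.arr 2 ((c : ℕ) * (m : ℤ) + (l : ℕ)) = extendRows k M c l := by
  induction c using Fin.addCases with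
  | left i => simpa [extendRows] using h.mat i l
  | right j =>
    rw [h.outside]
    · simp [extendRows]
    · rw [Fin.val_natAdd]
      push_cast
      nlinarith [Int.natCast_nonneg (j : ℕ), Int.natCast_nonneg (l : ℕ), Int.natCast_nonneg m,
        mul_nonneg (Int.natCast_nonneg (j : ℕ)) (Int.natCast_nonneg m)]

theorem abs_extendRows_mul_le {w : Fin m → ℤ} {μ α : ℤ} (hM : ∀ i l, |M i l| ≤ μ)
    (hw : ∀ l, |w l| ≤ α) (hμ : 0 ≤ μ) (c : Fin (m + k)) (l : Fin m) :
    |extendRows k M c l * w l| ≤ μ * α := by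
  rw [abs_mul]
  refine mul_le_mul ?_ (hw l) (abs_nonneg _) hμ
  induction c using Fin.addCases with
  | left i => simpa [extendRows] using hM i l
  | right j => simpa [extendRows] using hμ

/-! ### The basis of the relation lattice -/

/-- Write the column number `8` of the second block, reduced, into array `5`. -/
def loadColumn : Prog :=
  fill 5 (.const 0) (.var 2) (.var 1)
    (.read 2 (.var 3 * .var 1 + .var 4) * entry (.var 4) (.var 1 + .var 8))
    (Expr.mod (.var 5 + (Expr.var 3 - .var 1 - .var 8).isZero) (.var 7))

/-- The column number `j` of the second block, reduced. -/
def columnVec (N : Matrix (Fin m) (Fin k) ℤ) (M : Matrix (Fin m) (Fin m) ℤ) (d : ℤ) (j : Fin k)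
    (c : Fin (m + k)) : ℤ :=
  Fin.addCases (fun i => (M * N) i j) (fun l => if l = j then 1 else 0) c % d

theorem does_loadColumn {s : Mem} {β : ℕ} {μ α : ℤ} (hs : Prepared B N b M d s) (hd : d ≠ 0)
    (hdβ : |d| < 2 ^ β) (hn : bits (m + k : ℕ) ≤ β) (hM : ∀ i l, |M i l| ≤ μ) (hμ : 0 ≤ μ)
    (hN : ∀ i l, |N i l| ≤ α) (hY : m * (μ * α) < 2 ^ β) (j : Fin k) (h8 : s.var 8 = (j : ℕ)) :
    loadColumn.Does β s ((m + k) * (m * 4 + 10) + 3)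
      (fun s' => s.EqOff [3, 4, 5] [5] s' ∧ HoldsVec s' 5 (columnVec N M d j)) := by
  refine (does_fill_vec 0 (fun c l => extendRows k M c l * N l j) (columnVec N M d j) (μ * α) hn
    (bits_natCast_le (Nat.le_add_right m k) hn) (fun _ _ => rfl) ?_ ?_ ?_
    (abs_extendRows_mul_le hM (fun l => hN l j) hμ) hY ?_ ?_).imp ?_
  · intro s' h'
    simp [h'.1, hs.cols]
  · intro s' h'
    simp [h'.1, hs.rows]
  · intro c l s' h' h3 h4
    simp only [entry, Expr.eval_mul, Expr.eval_read, Expr.eval_add, Expr.eval_var, Expr.eval_const,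
      h3, h4, h'.var (v := 1) (by simp), h'.var (v := 2) (by simp), h'.var (v := 8) (by simp),
      h'.arr (a' := 2) (by simp), h'.arr (a' := 0) (by simp), hs.rows, hs.cols, h8]
    rw [hs.read_mat, hs.right]
  · intro c s' h' h3 h5
    simp only [Expr.eval_mod, Expr.eval_add, Expr.eval_var, Expr.eval_isZero, Expr.eval_sub, h3, h5,
      h'.var (v := 1) (by simp), h'.var (v := 7) (by simp), h'.var (v := 8) (by simp), hs.rows,
      hs.modulus, h8, columnVec]
    congr 1
    induction c using Fin.addCases with
    | left i =>
      have hne : ((i : ℕ) : ℤ) - m - (j : ℕ) ≠ 0 := by have := i.isLt; lia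
      simp [extendRows, hne, Matrix.mul_apply]
    | right l =>
      have hiff : (((m + l : ℕ) : ℤ) - m - (j : ℕ) = 0) ↔ l = j := by rw [Fin.ext_iff]; lia
      simp only [extendRows, Fin.addCases_right, Fin.val_natAdd, hiff]
      simp
  · intro c
    exact bits_le_of_abs_le (by
      rw [columnVec, abs_of_nonneg (Int.emod_nonneg _ hd)]; exact (Int.emod_lt_abs _ hd).le) hdβ
  · rintro s' ⟨h1, h2⟩
    exact ⟨h1.1, fun c => by simpa using h2 c⟩

/-- Array `6` becomes a triangular basis of the relation lattice. -/
def buildBasis : Prog :=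
  .seq (fillMap 6 (.const 0) (.var 2 * .var 2)
    (.var 7 * (.var 3 / .var 2 - (Expr.var 3).mod (.var 2)).isZero))
  (forLoop 8 (.var 2 - .var 1) (.seq loadColumn eliminate))

/-- The bound on the number of steps of `buildBasis`. -/
def buildBasisSteps (m k β : ℕ) : ℕ :=
  (m + k) * (m + k) * 10 + 3 +
    (k * ((m + k) * (m * 4 + 10) + 3 + eliminateSteps (m + k) β + 1 + 3) + 3) + 1

theorem does_buildBasis {s : Mem} {β : ℕ} {μ α : ℤ} (hs : Prepared B N b M d s) (hd : d ≠ 0)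
    (hdβ : |d| < 2 ^ β) (hnn : bits ((m + k) * (m + k) : ℕ) ≤ β) (hM : ∀ i l, |M i l| ≤ μ)
    (hμ : 0 ≤ μ) (hN : ∀ i l, |N i l| ≤ α) (hY : m * (μ * α) < 2 ^ β) :
    buildBasis.Does β s (buildBasisSteps m k β)
      (fun s' => s.EqOff [3, 4, 5, 8, 9, 10] [5, 6, 11] s' ∧
        ∃ T, HoldsMat s' 6 T ∧ IsTriBasis d T (congrLattice d (M * N) k)) := by
  have hn : bits (m + k : ℕ) ≤ β := bits_natCast_le (Nat.le_mul_self _) hnn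
  refine Prog.Does.seq (n := (m + k) * (m + k) * 10 + 3)
    (n' := k * ((m + k) * (m * 4 + 10) + 3 + eliminateSteps (m + k) β + 1 + 3) + 3)
    (does_fillMap_mat (p := m + k) (q := m + k) (fun a c => if a = c then d else 0) hnn
      ?_ ?_ ?_) ?_
  · intro s' h'
    simp [h'.1, hs.cols]
  · intro i j s' h' h3 hdiv hmod
    rw [Nat.cast_add] at hdiv hmod
    simp only [Expr.eval_mul, Expr.eval_isZero, Expr.eval_sub, Expr.eval_div, Expr.eval_mod,
      Expr.eval_var, h'.1 2 (by simp), h'.1 7 (by simp), hs.cols, hs.modulus, hdiv, hmod,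
      sub_eq_zero, Nat.cast_inj, Fin.ext_iff]
    split_ifs <;> simp
  · intro i j
    refine bits_le_of_abs_le (y := |d|) ?_ hdβ
    split_ifs <;> simp
  rintro s₁ ⟨e1, hT₁⟩
  refine (does_forLoop (n := (m + k) * (m * 4 + 10) + 3 + eliminateSteps (m + k) β + 1) (N := k)
    (fun j s' => s.EqOff [3, 4, 5, 8, 9, 10] [5, 6, 11] s' ∧
      ∃ T, HoldsMat s' 6 T ∧ IsTriBasis d T (congrLattice d (M * N) j))
    (bits_natCast_le (Nat.le_add_left k m) hn) ?_ ?_ ?_)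
  · exact ⟨(e1.1.mono (by simp) (by simp)).assign (by simp) _, _, hT₁, isTriBasis_diagonal hd _⟩
  · intro j _ s' h' _
    simp [h'.1.1, hs.rows, hs.cols]
  · rintro j hj s₂ - ⟨e2, T, hT, hbasis⟩ h8
    obtain ⟨j, rfl⟩ : ∃ i : Fin k, j = i := ⟨⟨j, hj⟩, rfl⟩
    have hs₂ : Prepared B N b M d s₂ := hs.eqOff e2 (by simp) (by simp)
    refine Prog.Does.seq (n := (m + k) * (m * 4 + 10) + 3) (n' := eliminateSteps (m + k) β)
      (does_loadColumn hs₂ hd hdβ hn hM hμ hN hY j h8) ?_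
    rintro s₃ ⟨e3, hv⟩
    have hs₃ : Prepared B N b M d s₃ := hs₂.eqOff e3 (by simp) (by simp)
    have hspan : congrLattice d (M * N) (j + 1) =
        congrLattice d (M * N) j ⊔ Submodule.span ℤ {columnVec N M d j} := by
      refine congrLattice_succ (fun i => ?_) fun l => ?_
      · rw [columnVec, Fin.addCases_left, ← dvd_neg, neg_sub]
        exact Int.dvd_self_sub_emod
      · rw [columnVec, Fin.addCases_right, ← dvd_neg, neg_sub]
        exact Int.dvd_self_sub_emod
    refine (does_eliminate (T := T) hd hdβ hn ?_ hs₃.modulus ?_ hv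
      (hbasis.inserting (isRem_mod hd _))).imp ?_
    · rw [hs₃.cols, Nat.cast_add]
    · intro a c
      rw [e3.2 6 (by simp)]
      exact hT a c
    rintro s₄ ⟨e4, T', hT', hbasis'⟩
    refine ⟨by rw [e4.1 8 (by simp), e3.1 8 (by simp), h8], ?_, T', hT', ?_⟩
    · exact (((e2.trans e3).trans e4).mono (by simp) (by simp)).assign (by simp) _
    · rw [hspan]; exact hbasis'

/-! ### The right hand side -/

/-- Write the negative of the transformed right hand side, reduced, into array `5`. -/
def loadTarget : Prog :=
  fill 5 (.const 0) (.var 2) (.var 1)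
    (.read 2 (.var 3 * .var 1 + .var 4) * rhs (.var 4))
    (Expr.mod (.const 0 - .var 5) (.var 7))

/-- The negative of the transformed right hand side, reduced. -/
def targetVec (k : ℕ) (b : Fin m → ℤ) (M : Matrix (Fin m) (Fin m) ℤ) (d : ℤ)
    (c : Fin (m + k)) : ℤ :=
  Fin.addCases (fun i => -M.mulVec b i) (fun _ => 0) c % d

theorem does_loadTarget {s : Mem} {β : ℕ} {μ α : ℤ} (hs : Prepared B N b M d s) (hd : d ≠ 0)
    (hdβ : |d| < 2 ^ β) (hn : bits (m + k : ℕ) ≤ β) (hM : ∀ i l, |M i l| ≤ μ) (hμ : 0 ≤ μ)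
    (hb : ∀ l, |b l| ≤ α) (hY : m * (μ * α) < 2 ^ β) :
    loadTarget.Does β s ((m + k) * (m * 4 + 10) + 3)
      (fun s' => s.EqOff [3, 4, 5] [5] s' ∧ HoldsVec s' 5 (targetVec k b M d)) := by
  refine (does_fill_vec 0 (fun c l => extendRows k M c l * b l) (targetVec k b M d) (μ * α) hn
    (bits_natCast_le (Nat.le_add_right m k) hn) (fun _ _ => rfl) ?_ ?_ ?_
    (abs_extendRows_mul_le hM hb hμ) hY ?_ ?_).imp ?_
  · intro s' h'
    simp [h'.1, hs.cols]
  · intro s' h'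
    simp [h'.1, hs.rows]
  · intro c l s' h' h3 h4
    simp only [rhs, Expr.eval_mul, Expr.eval_read, Expr.eval_add, Expr.eval_var, Expr.eval_const,
      h3, h4, h'.var (v := 1) (by simp), h'.var (v := 2) (by simp),
      h'.arr (a' := 2) (by simp), h'.arr (a' := 0) (by simp), hs.rows, hs.cols]
    rw [hs.read_mat, hs.rhs]
  · intro c s' h' h3 h5
    simp only [Expr.eval_mod, Expr.eval_var, Expr.eval_sub, Expr.eval_const, h5,
      h'.var (v := 7) (by simp), hs.modulus, targetVec]
    congr 1
    induction c using Fin.addCases with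
    | left i => simp [extendRows, Matrix.mulVec, dotProduct]
    | right l => simp [extendRows]
  · intro c
    exact bits_le_of_abs_le (by
      rw [targetVec, abs_of_nonneg (Int.emod_nonneg _ hd)]; exact (Int.emod_lt_abs _ hd).le) hdβ
  · rintro s' ⟨h1, h2⟩
    exact ⟨h1.1, fun c => by simpa using h2 c⟩

/-! ### The output -/

/-- Output the solution with the second block read off array `5`. -/
def outputSolution : Prog :=
  .seq (fill 11 (.const 0) (.var 1) (.var 2 - .var 1)
    (entry (.var 3) (.var 1 + .var 4) * .read 5 (.var 1 + .var 4)) (rhs (.var 3) - .var 5))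
  (.seq (fill 1 (.const 1) (.var 1) (.var 1)
    (.read 2 (.var 3 * .var 1 + .var 4) * .read 11 (.var 4)) (.var 5 / .var 7))
  (.seq (fillMap 1 (.const 1 + .var 1) (.var 2 - .var 1) (.read 5 (.var 1 + .var 3)))
  (.seq (.write 1 (.const 0) (.const 1)) (.assign 0 (.var 2 + .const 1)))))

theorem output_eq {s : Mem} {o : List ℤ} (h0 : s.var 0 = o.length)
    (h : ∀ i, (hi : i < o.length) → s.arr 1 (i : ℤ) = o[i]) : s.output = o := by
  apply List.ext_getElem
  · simp [Mem.output, h0]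
  · intro i h1 h2
    simp [Mem.output, h i h2]

theorem abs_mulVec_le {p q : ℕ} {W : Matrix (Fin p) (Fin q) ℤ} {z : Fin q → ℤ} {i : Fin p} {y : ℤ}
    (h : ∀ l, |W i l * z l| ≤ y) : |W.mulVec z i| ≤ q * y := by
  rw [Matrix.mulVec, dotProduct]
  refine (Finset.abs_sum_le_sum_abs _ _).trans ?_
  exact (Finset.sum_le_card_nsmul _ _ _ fun j _ => h j).trans (by simp)

/-- The bound on the number of steps of `outputSolution`. -/
def outputSteps (m k : ℕ) : ℕ :=
  m * (k * 4 + 10) + 3 + (m * (m * 4 + 10) + 3 + (k * 10 + 3 + (1 + 1 + 1) + 1) + 1) + 1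

theorem does_outputSolution {s : Mem} {β : ℕ} {μ α δ : ℤ} (hs : Prepared B N b M d s)
    (hdβ : δ < 2 ^ β) (hn : bits (m + k + 1 : ℕ) ≤ β) (hM : ∀ i l, |M i l| ≤ μ) (hμ : 0 ≤ μ)
    (hα : 0 ≤ α) (hN : ∀ i l, |N i l| ≤ α) (hb : ∀ l, |b l| ≤ α)
    {v : Fin (m + k) → ℤ} (hv : HoldsVec s 5 v) (hvδ : ∀ c, |v c| ≤ δ)
    (hY₁ : α + k * (α * δ) < 2 ^ β) (hY₂ : m * (μ * (α + k * (α * δ))) < 2 ^ β)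
    {x : Fin m → ℤ} {z : Fin k → ℤ} (hz : ∀ j, z j = v (Fin.natAdd m j))
    (hx : ∀ i, x i = M.mulVec (b - N.mulVec z) i / d) :
    outputSolution.Does β s (outputSteps m k)
      (fun s' => s'.output = 1 :: encodeVec (Sum.elim x z)) := by
  have hn' : bits (m + k : ℕ) ≤ β := bits_natCast_le (Nat.le_succ _) hn
  have hbm : bits m ≤ β := bits_natCast_le (Nat.le_add_right m k) hn'
  have hbk : bits k ≤ β := bits_natCast_le (Nat.le_add_left k m) hn'
  have hzδ : ∀ j, |z j| ≤ δ := fun j => hz j ▸ hvδ _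
  have hNz : ∀ i j, |N i j * z j| ≤ α * δ := fun i j => by
    rw [abs_mul]; exact mul_le_mul (hN i j) (hzδ j) (abs_nonneg _) hα
  have hres : ∀ i, |(b - N.mulVec z) i| ≤ α + k * (α * δ) := by
    intro i
    exact (abs_sub _ _).trans (add_le_add (hb i) (abs_mulVec_le (hNz i)))
  have hMr : ∀ i l, |M i l * (b - N.mulVec z) l| ≤ μ * (α + k * (α * δ)) := fun i l => by
    rw [abs_mul]; exact mul_le_mul (hM i l) (hres l) (abs_nonneg _) hμ
  refine Prog.Does.seq (n := m * (k * 4 + 10) + 3)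
    (n' := m * (m * 4 + 10) + 3 + (k * 10 + 3 + (1 + 1 + 1) + 1) + 1)
    (does_fill_vec 0 (fun i j => N i j * z j) (b - N.mulVec z) (α * δ) hbm hbk (fun _ _ => rfl)
      ?_ ?_ ?_ hNz ?_ ?_ ?_) ?_
  · intro s' h'
    simp [h'.1, hs.rows]
  · intro s' h'
    simp [h'.1, hs.rows, hs.cols]
  · intro c l s' h' h3 h4
    simp only [entry, Expr.eval_mul, Expr.eval_read, Expr.eval_add, Expr.eval_var, Expr.eval_const,
      h3, h4, h'.var (v := 1) (by simp), h'.var (v := 2) (by simp),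
      h'.arr (a' := 5) (by simp), h'.arr (a' := 0) (by simp), hs.rows, hs.cols]
    have := hv (Fin.natAdd m l)
    rw [Fin.val_natAdd, Nat.cast_add] at this
    rw [hs.right, this, hz]
  · linarith
  · intro c s' h' h3 h5
    simp only [rhs, Expr.eval_read, Expr.eval_add, Expr.eval_var, Expr.eval_const, Expr.eval_sub,
      Expr.eval_mul, h3, h5, h'.var (v := 1) (by simp), h'.var (v := 2) (by simp),
      h'.arr (a' := 0) (by simp), hs.rows, hs.cols]
    rw [hs.rhs]
    rfl
  · exact fun i => bits_le_of_abs_le (hres i) hY₁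
  rintro s₁ ⟨e1, hr⟩
  have hs₁ : Prepared B N b M d s₁ := hs.eqOff e1.1 (by simp) (by simp)
  refine Prog.Does.seq (n := m * (m * 4 + 10) + 3) (n' := k * 10 + 3 + (1 + 1 + 1) + 1)
    (does_fill_vec 1 (fun i l => M i l * (b - N.mulVec z) l) x (μ * (α + k * (α * δ))) hbm hbm
      (fun _ _ => rfl) ?_ ?_ ?_ hMr hY₂ ?_ ?_) ?_
  · intro s' h'
    simp [h'.1, hs₁.rows]
  · intro s' h'
    simp [h'.1, hs₁.rows]
  · intro c l s' h' h3 h4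
    simp only [Expr.eval_mul, Expr.eval_read, Expr.eval_add, Expr.eval_var,
      h3, h4, h'.var (v := 1) (by simp),
      h'.arr (a' := 11) (by simp), h'.arr (a' := 2) (by simp), hs₁.rows]
    have := hr l
    rw [zero_add] at this
    rw [hs₁.mat c l, this]
  · intro c s' h' h3 h5
    simp only [Expr.eval_div, Expr.eval_var, h5, h'.var (v := 7) (by simp), hs₁.modulus]
    rw [hx]
    rfl
  · intro i
    rw [hx]
    exact bits_le_of_abs_le ((Int.abs_ediv_le_abs _ _).trans (abs_mulVec_le (hMr i))) hY₂
  rintro s₂ ⟨e2, hxs⟩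
  have hs₂ : Prepared B N b M d s₂ := hs₁.eqOff e2.1 (by simp) (by simp)
  refine Prog.Does.seq (n := k * 10 + 3) (n' := 1 + 1 + 1)
    (does_fillMap_vec (1 + m : ℤ) z hbk ?_ ?_ ?_ ?_) ?_
  · intro s' h'
    simp [h'.1, hs₂.rows]
  · intro s' h'
    simp [h'.1, hs₂.rows, hs₂.cols]
  · intro c s' h' h3
    simp only [Expr.eval_read, Expr.eval_add, Expr.eval_var, h3, h'.var (v := 1) (by simp),
      h'.arr (a' := 5) (by simp), e2.arr (a' := 5) (by simp), e1.arr (a' := 5) (by simp), hs₂.rows]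
    have := hv (Fin.natAdd m c)
    rw [Fin.val_natAdd, Nat.cast_add] at this
    rw [this, hz]
  · exact fun j => bits_le_of_abs_le (hzδ j) hdβ
  rintro s₃ ⟨e3, hzs⟩
  have hs₃ : Prepared B N b M d s₃ := hs₂.eqOff e3.1 (by simp) (by simp)
  have h1β : bits 1 ≤ β := bits_natCast_le (N := 1) (by lia) hn
  refine Prog.Does.seq (n := 1) (n' := 1) (Prog.does_write
    (Q := fun s' => s' = s₃.write 1 0 1) h1β rfl) ?_
  rintro _ rfl
  refine Prog.does_assign ?_ ?_
  · simpa [hs₃.cols] using hn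
  apply output_eq
  · simp [hs₃.cols, encodeVec]
  · intro i hi
    simp only [encodeVec, List.length_cons, List.length_append, List.length_ofFn] at hi
    rw [Mem.assign_arr, Mem.write_arr]
    cases i with
    | zero => simp
    | succ i =>
      have hi0 : ((i + 1 : ℕ) : ℤ) ≠ 0 := by lia
      simp only [hi0, and_false, if_false, encodeVec, List.getElem_cons_succ]
      by_cases him : i < m
      · rw [List.getElem_append_left (by simpa using him), List.getElem_ofFn,
          e3.arr_self (by left; push_cast; lia)]
        have := hxs ⟨i, him⟩
        rw [Nat.cast_succ, add_comm]
        simpa using this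
      · rw [List.getElem_append_right (by simpa using him), List.getElem_ofFn]
        have := hzs ⟨i - m, by lia⟩
        simp only [List.length_ofFn, Sum.elim_inr]
        rw [← this]
        congr 1
        push_cast [Nat.cast_sub (not_lt.1 him)]
        ring

end BitRAM

namespace BitRAM

open Lattice Matrix

variable {m k : ℕ} {B : Matrix (Fin m) (Fin m) ℤ} {N : Matrix (Fin m) (Fin k) ℤ} {b : Fin m → ℤ}

/-! ### The input -/

theorem getD_flatten {q : ℕ} {L : List (List ℤ)} (hL : ∀ l ∈ L, l.length = q) {i j : ℕ}
    (hi : i < L.length) (hj : j < q) :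
    L.flatten.getD (i * q + j) 0 = (L.getD i []).getD j 0 := by
  induction L generalizing i with
  | nil => simp at hi
  | cons l L ih =>
    have hl : l.length = q := hL l (by simp)
    rw [List.flatten_cons]
    cases i with
    | zero =>
      rw [zero_mul, zero_add, List.getD_append _ _ _ _ (by lia)]
      rfl
    | succ i =>
      rw [List.getD_append_right _ _ _ _ (by rw [hl]; nlinarith), hl,
        show (i + 1) * q + j - q = i * q + j by rw [add_mul, one_mul]; lia,
        ih (fun l' h' => hL l' (by simp [h'])) (by simpa using hi)]
      rfl

theorem length_flatten_of_forall {q : ℕ} {L : List (List ℤ)} (hL : ∀ l ∈ L, l.length = q) :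
    L.flatten.length = L.length * q := by
  induction L with
  | nil => simp
  | cons l L ih =>
    rw [List.flatten_cons, List.length_append, ih fun l' h' => hL l' (by simp [h']),
      hL l (by simp), List.length_cons]
    ring

/-- The list of rows of the matrix. -/
def rowList (B : Matrix (Fin m) (Fin m) ℤ) (N : Matrix (Fin m) (Fin k) ℤ) : List (List ℤ) :=
  List.ofFn fun i => List.ofFn (B i) ++ List.ofFn (N i)

theorem length_of_mem_rowList : ∀ l ∈ rowList B N, l.length = m + k := by
  intro l hl
  obtain ⟨i, rfl⟩ := List.mem_ofFn.1 hl
  simp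

theorem length_flatten_rowList : (rowList B N).flatten.length = m * (m + k) := by
  rw [length_flatten_of_forall length_of_mem_rowList]
  simp [rowList]

theorem encodeSystem_eq : encodeSystem B N b =
    (m : ℤ) :: ((m + k : ℕ) : ℤ) :: ((rowList B N).flatten ++ List.ofFn b) := rfl

theorem encodeSystem_entry (i : Fin m) {j : ℕ} (hj : j < m + k) :
    (encodeSystem B N b).getD (2 + i * (m + k) + j) 0 =
      (List.ofFn (B i) ++ List.ofFn (N i)).getD j 0 := by
  rw [encodeSystem_eq, show 2 + i.val * (m + k) + j = (i.val * (m + k) + j) + 1 + 1 by ring,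
    List.getD_cons_succ, List.getD_cons_succ, List.getD_append,
    getD_flatten length_of_mem_rowList (by simp [rowList]) hj]
  · simp [rowList, List.getD_eq_getElem?_getD]
  · rw [length_flatten_rowList]
    exact cell_lt i ⟨j, hj⟩

theorem encodeSystem_rhs (i : Fin m) :
    (encodeSystem B N b).getD (2 + m * (m + k) + i) 0 = b i := by
  rw [encodeSystem_eq, show 2 + m * (m + k) + i.val = (m * (m + k) + i) + 1 + 1 by ring,
    List.getD_cons_succ, List.getD_cons_succ, List.getD_append_right, length_flatten_rowList]
  · simp [List.getD_eq_getElem?_getD]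
  · rw [length_flatten_rowList]
    lia

theorem ofInput_arr_zero (l : List ℤ) (i : ℕ) : (Mem.ofInput l).arr 0 i = l.getD i 0 := by
  simp [Mem.ofInput]

theorem loaded_of_ofInput {s : Mem} (h0 : s.arr 0 = (Mem.ofInput (encodeSystem B N b)).arr 0)
    (h1 : s.var 1 = m) (h2 : s.var 2 = m + k) : Loaded B N b s where
  rows := h1
  cols := h2
  left i j := by
    have := ofInput_arr_zero (encodeSystem B N b) (2 + i * (m + k) + j)
    rw [encodeSystem_entry i (by lia)] at this
    push_cast at this
    rw [h0, this, List.getD_append _ _ _ _ (by simp)]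
    simp [List.getD_eq_getElem?_getD]
  right i j := by
    have := ofInput_arr_zero (encodeSystem B N b) (2 + i * (m + k) + (m + j))
    rw [encodeSystem_entry i (by lia)] at this
    push_cast at this
    rw [h0, this, List.getD_append_right _ _ _ _ (by simp)]
    simp [List.getD_eq_getElem?_getD]
  rhs i := by
    have := ofInput_arr_zero (encodeSystem B N b) (2 + m * (m + k) + i)
    rw [encodeSystem_rhs] at this
    push_cast at this
    rw [h0, this]

theorem bits_lt_inputSize {l : List ℤ} {z : ℤ} (hz : z ∈ l) : bits z < inputSize l := by
  have : bits z + 1 ≤ inputSize l :=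
    List.single_le_sum (fun _ _ => Nat.zero_le _) _ (List.mem_map_of_mem hz)
  lia

theorem bits_getD_le (l : List ℤ) (i : ℕ) : bits (l.getD i 0) ≤ inputSize l := by
  by_cases hi : i < l.length
  · rw [List.getD_eq_getElem _ _ hi]
    exact (bits_lt_inputSize (List.getElem_mem hi)).le
  · rw [List.getD_eq_default _ _ (not_lt.1 hi)]
    simp [bits]

theorem ofInput_bounded (l : List ℤ) {β : ℕ} (h : inputSize l ≤ β) :
    (Mem.ofInput l).Bounded β := by
  refine ⟨fun v => by simp [Mem.ofInput, bits], fun a i => ?_⟩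
  simp only [Mem.ofInput]
  split_ifs
  · exact (bits_getD_le l _).trans h
  · simp [bits]

theorem length_le_inputSize (l : List ℤ) : l.length ≤ inputSize l := by
  induction l with
  | nil => simp [inputSize]
  | cons z l ih =>
    simp only [inputSize, List.map_cons, List.sum_cons, List.length_cons] at ih ⊢
    lia

theorem length_encodeSystem : (encodeSystem B N b).length = m * (m + k) + m + 2 := by
  rw [encodeSystem_eq, List.length_cons, List.length_cons, List.length_append,
    length_flatten_rowList, List.length_ofFn]

/-! ### The algorithm -/

/-- The algorithm. -/
def solver : Prog :=
  .seq (.assign 1 (.read 0 (.const 0)))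
  (.seq (.assign 2 (.read 0 (.const 1)))
  (.seq faddeev
  (.seq buildBasis
  (.seq loadTarget
  (.seq reduce
  (.seq (sumTo (.var 1) (.read 5 (.var 4)))
  (.cond (.var 5) (.seq (.write 1 (.const 0) (.const 0)) (.assign 0 (.const 1)))
    outputSolution)))))))

/-- The bound on the number of steps of `solver` after the recursion. -/
def finishSteps (m k β : ℕ) : ℕ :=
  buildBasisSteps m k β + ((m + k) * (m * 4 + 10) + 3 + ((m + k) * ((m + k) * 10 + 8) + 3 +
    (m * 4 + 5 + (outputSteps m k + 1) + 1) + 1) + 1) + 1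

theorem does_finish {s : Mem} {M : Matrix (Fin m) (Fin m) ℤ} {d : ℤ} {β : ℕ} {α X : ℤ}
    (hs : Prepared B N b M d s) (hd : d ≠ 0) (hB : B.det ≠ 0) (hMB : M * B = d • 1)
    (hBM : B * M = d • 1)
    (hdeep : (WithLp.toLp 2 fun i => (b i : ℝ)) ∈ deepCone B (maxColLength N *
      ((|B.det| : ℤ) / (gcdMinors (fromCols B N) : ℝ) - 1)))
    (hdX : |d| ≤ X) (hM : ∀ i l, |M i l| ≤ X) (hα : 1 ≤ α) (hN : ∀ i l, |N i l| ≤ α)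
    (hb : ∀ l, |b l| ≤ α) (hnn : bits ((m + k + 1) * (m + k + 1) : ℕ) ≤ β)
    (hX : X < 2 ^ β) (hmX : m * (X * α) < 2 ^ β)
    (hY₁ : α + k * (α * X) < 2 ^ β) (hY₂ : m * (X * (α + k * (α * X))) < 2 ^ β) :
    (Prog.seq buildBasis (.seq loadTarget (.seq reduce
      (.seq (sumTo (.var 1) (.read 5 (.var 4)))
      (.cond (.var 5) (.seq (.write 1 (.const 0) (.const 0)) (.assign 0 (.const 1)))
        outputSolution))))).Does β s (finishSteps m k β)
      (fun s' => IsCorrectAnswer (fromCols B N) b s'.output) := by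
  have hX0 : 0 ≤ X := (abs_nonneg d).trans hdX
  have hdβ := hdX.trans_lt hX
  have hn1 : bits (m + k + 1 : ℕ) ≤ β := bits_natCast_le (Nat.le_mul_self _) hnn
  have hn : bits (m + k : ℕ) ≤ β := bits_natCast_le (Nat.le_succ _) hn1
  have hbm : bits m ≤ β := bits_natCast_le (Nat.le_add_right m k) hn
  have h1β : bits 1 ≤ β := bits_natCast_le (N := 1) (by lia) hn1
  refine Prog.Does.seq (n := buildBasisSteps m k β)
    (n' := (m + k) * (m * 4 + 10) + 3 + ((m + k) * ((m + k) * 10 + 8) + 3 +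
      (m * 4 + 5 + (outputSteps m k + 1) + 1) + 1) + 1)
    (does_buildBasis hs hd hdβ
      (bits_natCast_le (Nat.mul_le_mul (Nat.le_succ _) (Nat.le_succ _)) hnn) hM hX0 hN hmX) ?_
  rintro s₁ ⟨e1, T, hT, hbasis⟩
  have hs₁ : Prepared B N b M d s₁ := hs.eqOff e1 (by simp) (by simp)
  refine Prog.Does.seq (n := (m + k) * (m * 4 + 10) + 3)
    (n' := (m + k) * ((m + k) * 10 + 8) + 3 + (m * 4 + 5 + (outputSteps m k + 1) + 1) + 1)
    (does_loadTarget hs₁ hd hdβ hn hM hX0 hb hmX) ?_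
  rintro s₂ ⟨e2, hv⟩
  have hs₂ : Prepared B N b M d s₂ := hs₁.eqOff e2 (by simp) (by simp)
  refine Prog.Does.seq (n := (m + k) * ((m + k) * 10 + 8) + 3)
    (n' := m * 4 + 5 + (outputSteps m k + 1) + 1)
    (does_reduce (T := T) hd hdβ hn (by rw [hs₂.cols, Nat.cast_add]) hs₂.modulus
      (fun a c => by rw [e2.2 6 (by simp)]; exact hT a c) hv hbasis (isRem_mod hd _)) ?_
  rintro s₃ ⟨e3, v, hv₃, hrem, hred, hmem⟩
  have hs₃ : Prepared B N b M d s₃ := hs₂.eqOff e3 (by simp) (by simp)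
  have hvX : ∀ c, |v c| ≤ X := fun c => by
    rw [abs_of_nonneg (hrem c).1]; exact (hrem c).2.le.trans hdX
  have h₀ : ∀ i, d ∣ targetVec k b M d (Fin.castAdd k i) + M.mulVec b i := by
    intro i
    rw [targetVec, Fin.addCases_left, ← dvd_neg, neg_add, neg_add_eq_sub]
    exact Int.dvd_self_sub_emod
  have h₀' : ∀ j, d ∣ targetVec k b M d (Fin.natAdd m j) := by
    intro j
    rw [targetVec, Fin.addCases_right, Int.zero_emod]
    exact dvd_zero d
  refine Prog.Does.seq (n := m * 4 + 5) (n' := outputSteps m k + 1)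
    (does_sumTo_fin (N := m) (fun i => v (Fin.castAdd k i)) X hbm ?_ ?_ (fun _ => hvX _) ?_) ?_
  · intro s' h'
    simp [h'.1, hs₃.rows]
  · intro i s' h' h4
    simp only [Expr.eval_read, Expr.eval_var, h4, h'.2 5 (by simp)]
    exact hv₃ (Fin.castAdd k i)
  · refine lt_of_le_of_lt (mul_le_mul_of_nonneg_left ?_ (Int.natCast_nonneg m)) hmX
    exact le_mul_of_one_le_right hX0 hα
  rintro s₄ ⟨e4, h5⟩
  have hs₄ : Prepared B N b M d s₄ := hs₃.eqOff e4 (by simp) (by simp)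
  refine Prog.does_cond (fun hpos => ?_) (fun hneg => ?_)
  · rw [Expr.eval_var, h5] at hpos
    refine (Prog.Does.seq (n := 1) (n' := 1) (Prog.does_write (Q := fun s' => s' = s₄.write 1 0 0)
      (by simp [bits]) rfl) ?_ (R := fun s' => s'.output = [0])).mono ?_ ?_
    · rintro _ rfl
      refine Prog.does_assign h1β (output_eq (by simp) fun i hi => ?_)
      obtain rfl : i = 0 := by simpa using hi
      simp [Mem.write_arr]
    · unfold outputSteps; lia
    · rintro s' - h'
      refine Or.inr ⟨?_, h'⟩
      rintro ⟨x, -, hx⟩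
      refine hpos.ne' (Finset.sum_eq_zero fun i _ => ?_)
      exact head_eq_zero_of_solution hMB hbasis h₀ h₀' hrem hred hmem hx i
  · rw [Expr.eval_var, h5] at hneg
    have hzero : ∀ i, v (Fin.castAdd k i) = 0 := fun i =>
      (Finset.sum_eq_zero_iff_of_nonneg fun i _ => (hrem _).1).1
        (le_antisymm (not_lt.1 hneg) (Finset.sum_nonneg fun i _ => (hrem _).1)) i
        (Finset.mem_univ i)
    let z : Fin k → ℤ := fun j => v (Fin.natAdd m j)
    refine (does_outputSolution hs₄ hX hn1 hM hX0 (by lia) hN hb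
      (fun c => by rw [e4.2 5 (by simp)]; exact hv₃ c) hvX hY₁ hY₂ (z := z)
      (x := fun i => M.mulVec (b - N.mulVec z) i / d) (fun _ => rfl) (fun _ => rfl)).imp ?_
    intro s' h'
    have hsol := solution_of_head_eq_zero hd hB hMB hBM hdeep hbasis h₀ h₀' hrem hred hmem hzero
      (z := z) (x := fun i => M.mulVec (b - N.mulVec z) i / d) (fun _ => rfl) (fun _ => rfl)
    exact Or.inl ⟨_, hsol.1, hsol.2, h'⟩

/-- The bound on the number of steps of `solver`. -/
def solverSteps (m k β : ℕ) : ℕ :=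
  m * (m * m * (m * 4 + 30) + 33) + 10 + finishSteps m k β + 5

/-- The bound on the binary lengths of all numbers in the memory, in terms of the input size. -/
def sizeBound (S : ℕ) : ℕ := 4 * S ^ 2 + 5 * S + 4

theorem does_solver (hm : 0 < m) (hB : B.det ≠ 0)
    (hdeep : (WithLp.toLp 2 fun i => (b i : ℝ)) ∈ deepCone B (maxColLength N *
      ((|B.det| : ℤ) / (gcdMinors (fromCols B N) : ℝ) - 1))) :
    solver.Does (sizeBound (inputSize (encodeSystem B N b))) (Mem.ofInput (encodeSystem B N b))
      (solverSteps m k (sizeBound (inputSize (encodeSystem B N b))))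
      (fun s' => IsCorrectAnswer (fromCols B N) b s'.output) := by
  set l := encodeSystem B N b with hl
  set S := inputSize l
  set β := sizeBound S with hβ
  have hlen : m * (m + k) + m + 2 ≤ S := length_encodeSystem ▸ length_le_inputSize l
  have hnS : m + k ≤ S := by nlinarith
  have hmS : m ≤ S := by lia
  have hmmS : m * m ≤ S := by nlinarith
  have hS : S < 2 ^ S := Nat.lt_two_pow_self
  have hentry : ∀ i, |l.getD i 0| ≤ 2 ^ S := fun i => (bits_le_iff.1 (bits_getD_le l i)).le
  have hBα : ∀ i j, |B i j| ≤ 2 ^ S := by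
    intro i j
    have := hentry (2 + i * (m + k) + j)
    rw [hl, encodeSystem_entry i (by lia), List.getD_append _ _ _ _ (by simp)] at this
    simpa [List.getD_eq_getElem?_getD] using this
  have hNα : ∀ i j, |N i j| ≤ 2 ^ S := by
    intro i j
    have := hentry (2 + i * (m + k) + (m + j))
    rw [hl, encodeSystem_entry i (by lia), List.getD_append_right _ _ _ _ (by simp)] at this
    simpa [List.getD_eq_getElem?_getD] using this
  have hbα : ∀ i, |b i| ≤ 2 ^ S := by
    intro i
    have := hentry (2 + m * (m + k) + i)
    rwa [hl, encodeSystem_rhs] at this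
  have hm2 : (m : ℤ) ≤ 2 ^ S := by exact_mod_cast hmS.trans hS.le
  have hk2 : (k : ℤ) ≤ 2 ^ S := by exact_mod_cast ((Nat.le_add_left k m).trans hnS).trans hS.le
  have hmm2 : (m : ℤ) ^ 2 ≤ 2 ^ S := by rw [sq]; exact_mod_cast hmmS.trans hS.le
  have hα : (1 : ℤ) ≤ 2 ^ S := one_le_pow₀ (by norm_num)
  have hpow : ∀ {i j : ℕ}, i ≤ j → (2 : ℤ) ^ i ≤ 2 ^ j := fun h =>
    pow_le_pow_right₀ (by norm_num) h
  have hlt : ∀ {i : ℕ} {y : ℤ}, y ≤ 2 ^ i → i < β → y < 2 ^ β := fun h h' =>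
    h.trans_lt (pow_lt_pow_right₀ (by norm_num) h')
  obtain ⟨e, he⟩ : ∃ e, e = 2 * S ^ 2 + S + 1 := ⟨_, rfl⟩
  have hβe : β = 3 * S + 2 * e + 2 := by rw [hβ, sizeBound, he]; ring
  have hx : ∀ t ≤ m, 2 * (2 * (m : ℤ) ^ 2 * 2 ^ S) ^ t ≤ 2 ^ e := by
    intro t ht
    have h1 : 2 * (m : ℤ) ^ 2 * 2 ^ S ≤ 2 ^ (2 * S + 1) := by
      calc 2 * (m : ℤ) ^ 2 * 2 ^ S ≤ 2 * 2 ^ S * 2 ^ S := by gcongr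
        _ = 2 ^ (2 * S + 1) := by ring
    calc 2 * (2 * (m : ℤ) ^ 2 * 2 ^ S) ^ t ≤ 2 * (2 ^ (2 * S + 1)) ^ t := by gcongr
      _ = 2 ^ ((2 * S + 1) * t + 1) := by rw [← pow_mul, pow_succ, mul_comm]
      _ ≤ 2 ^ e := hpow (by rw [he]; nlinarith [Nat.mul_le_mul_left (2 * S + 1) (ht.trans hmS)])
  have hfl : ∀ t ≤ m, (∀ i j, |B.flMat t i j| ≤ 2 ^ e) ∧
      (∀ i j, |(B * B.flMat t) i j| ≤ 2 ^ e) ∧ |B.flCoeff t| ≤ 2 ^ e := by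
    intro t ht
    obtain ⟨h1, h2, h3⟩ := abs_fl_le B hm hα hBα ht
    have h4 : (2 * (m : ℤ) ^ 2 * 2 ^ S) ^ t ≤ 2 ^ e := by
      have : 0 ≤ (2 * (m : ℤ) ^ 2 * 2 ^ S) ^ t := by positivity
      linarith [hx t ht]
    exact ⟨fun i j => (h1 i j).trans (hx t ht), fun i j => (h2 i j).trans h4, h3.trans h4⟩
  have hmX : (m : ℤ) * (2 ^ S * 2 ^ e) ≤ 2 ^ (2 * S + e) := by
    calc (m : ℤ) * (2 ^ S * 2 ^ e) ≤ 2 ^ S * (2 ^ S * 2 ^ e) := by gcongr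
      _ = 2 ^ (2 * S + e) := by ring
  have hY₁ : (2 : ℤ) ^ S + k * (2 ^ S * 2 ^ e) ≤ 2 ^ (2 * S + e + 1) := by
    calc (2 : ℤ) ^ S + k * (2 ^ S * 2 ^ e) ≤ 2 ^ (2 * S + e) + 2 ^ S * (2 ^ S * 2 ^ e) :=
          add_le_add (hpow (by lia)) (mul_le_mul_of_nonneg_right hk2 (by positivity))
      _ = 2 ^ (2 * S + e + 1) := by ring
  have hY₂ : (m : ℤ) * (2 ^ e * (2 ^ S + k * (2 ^ S * 2 ^ e))) ≤ 2 ^ (3 * S + 2 * e + 1) := by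
    calc (m : ℤ) * (2 ^ e * (2 ^ S + k * (2 ^ S * 2 ^ e)))
        ≤ 2 ^ S * (2 ^ e * 2 ^ (2 * S + e + 1)) := by gcongr
      _ = 2 ^ (3 * S + 2 * e + 1) := by ring
  have hnn : bits ((m + k + 1) * (m + k + 1) : ℕ) ≤ β := by
    have h1 : m + k + 1 ≤ 2 ^ S := by lia
    have h2 := Nat.mul_le_mul h1 h1
    refine bits_le_of_abs_le (y := 2 ^ (2 * S)) ?_ (hlt le_rfl (by lia))
    rw [Nat.abs_cast, two_mul, pow_add]
    exact_mod_cast h2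
  have hmm : bits (m * m : ℕ) ≤ β :=
    bits_natCast_le (Nat.mul_le_mul (by lia) (by lia)) hnn
  have hl0 : (Mem.ofInput l).arr 0 0 = m := ofInput_arr_zero l 0
  have hl1 : (Mem.ofInput l).arr 0 1 = (m + k : ℕ) := ofInput_arr_zero l 1
  have hSβ : S ≤ β := by lia
  refine (Prog.Does.seq (n := 1)
    (n' := 1 + (m * (m * m * (m * 4 + 30) + 33) + 10 + finishSteps m k β + 1) + 1)
    (Prog.does_assign (Q := fun s' => s' = (Mem.ofInput l).assign 1 m) ?_ ?_) ?_).mono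
    (by unfold solverSteps; lia) fun _ _ h => h
  · simp only [Expr.eval_read, Expr.eval_const, hl0]
    exact bits_natCast_le (by nlinarith) hmm
  · simp only [Expr.eval_read, Expr.eval_const, hl0]
  rintro _ rfl
  refine Prog.Does.seq (n := 1)
    (n' := m * (m * m * (m * 4 + 30) + 33) + 10 + finishSteps m k β + 1) (Prog.does_assign
    (Q := fun s' => s' = ((Mem.ofInput l).assign 1 m).assign 2 (m + k : ℕ)) ?_ ?_) ?_
  · simp only [Expr.eval_read, Expr.eval_const, Mem.assign_arr, hl1]
    exact bits_natCast_le (by nlinarith) hnn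
  · simp only [Expr.eval_read, Expr.eval_const, Mem.assign_arr, hl1]
  rintro _ rfl
  have hload : Loaded B N b (((Mem.ofInput l).assign 1 m).assign 2 (m + k : ℕ)) :=
    loaded_of_ofInput rfl (by simp) (by simp)
  refine Prog.Does.seq (n := m * (m * m * (m * 4 + 30) + 33) + 10) (n' := finishSteps m k β)
    (does_faddeev hload hm (fun _ => rfl) (fun _ => rfl) hmm (hlt hmX (by lia)) hα hBα hfl) ?_
  rintro s ⟨e1, hM, hout, h7⟩
  have hs : Prepared B N b (B.flMat m) (-B.flCoeff m) s :=
    ⟨hload.eqOff e1 (by simp) (by simp) (by simp), hM, hout, h7⟩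
  have hBM := B.mul_flMat
  have hMB : B.flMat m * B = -B.flCoeff m • 1 := by
    have h1 : B * (B.flMat m * B - -B.flCoeff m • 1) = 0 := by
      rw [mul_sub, ← mul_assoc, hBM, smul_mul_assoc, mul_smul_comm, one_mul, mul_one, sub_self]
    have h2 := congrArg (B.adjugate * ·) h1
    simp only [← mul_assoc, adjugate_mul, smul_mul_assoc, one_mul, mul_zero] at h2
    exact sub_eq_zero.1 ((smul_eq_zero.1 h2).resolve_left hB)
  refine does_finish (α := 2 ^ S) (X := 2 ^ e) hs (neg_ne_zero.2 (B.flCoeff_ne_zero hB)) hB hMB hBM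
    hdeep ?_ (hfl m le_rfl).1 hα hNα hbα hnn (hlt le_rfl (by lia)) ?_ (hlt hY₁ (by lia))
    (hlt hY₂ (by lia))
  · rw [abs_neg]
    exact (hfl m le_rfl).2.2
  · rw [mul_comm ((2 : ℤ) ^ e)]
    exact hlt hmX (by lia)

/-! ### Polynomial bounds -/

/-- The function is the evaluation of a polynomial. -/
def IsPoly (f : ℕ → ℕ) : Prop := ∃ P : Polynomial ℕ, ∀ n, P.eval n = f n

theorem IsPoly.const (c : ℕ) : IsPoly fun _ => c := ⟨.C c, by simp⟩

theorem IsPoly.id : IsPoly fun n => n := ⟨.X, by simp⟩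

theorem IsPoly.add {f g : ℕ → ℕ} (hf : IsPoly f) (hg : IsPoly g) : IsPoly fun n => f n + g n := by
  obtain ⟨P, hP⟩ := hf
  obtain ⟨Q, hQ⟩ := hg
  exact ⟨P + Q, fun n => by rw [Polynomial.eval_add, hP, hQ]⟩

theorem IsPoly.mul {f g : ℕ → ℕ} (hf : IsPoly f) (hg : IsPoly g) : IsPoly fun n => f n * g n := by
  obtain ⟨P, hP⟩ := hf
  obtain ⟨Q, hQ⟩ := hg
  exact ⟨P * Q, fun n => by rw [Polynomial.eval_mul, hP, hQ]⟩

theorem isPoly_solverSteps (w : ℕ) :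
    IsPoly fun S => solverSteps S S (sizeBound S) * stepCost w (sizeBound S) := by
  unfold solverSteps finishSteps buildBasisSteps eliminateSteps outputSteps stepCost sizeBound
  simp only [pow_two]
  repeat' first
    | exact IsPoly.const _
    | exact IsPoly.id
    | apply IsPoly.add
    | apply IsPoly.mul

theorem solverSteps_mono {m k S : ℕ} (hm : m ≤ S) (hk : k ≤ S) (β : ℕ) :
    solverSteps m k β ≤ solverSteps S S β := by
  unfold solverSteps finishSteps buildBasisSteps eliminateSteps outputSteps
  gcongr

end BitRAM

theorem theorem1 :
    ∃ (p : BitRAM.Prog) (P : Polynomial ℕ),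
      ∀ (m k : ℕ) (B : Matrix (Fin m) (Fin m) ℤ) (N : Matrix (Fin m) (Fin k) ℤ) (b : Fin m → ℤ),
        0 < m → 0 < k → B.det ≠ 0 →
        (WithLp.toLp 2 fun i => (b i : ℝ)) ∈
          deepCone B (maxColLength N *
            ((|B.det| : ℤ) / (gcdMinors (Matrix.fromCols B N) : ℝ) - 1)) →
        ∃ o : List ℤ,
          p.OutputsInTime (encodeSystem B N b) o
            (P.eval (BitRAM.inputSize (encodeSystem B N b))) ∧
          IsCorrectAnswer (Matrix.fromCols B N) b o := by
  obtain ⟨P, hP⟩ := BitRAM.isPoly_solverSteps BitRAM.solver.weight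
  refine ⟨BitRAM.solver, P, fun m k B N b hm _ hB hdeep => ?_⟩
  have hlen := BitRAM.length_le_inputSize (encodeSystem B N b)
  rw [BitRAM.length_encodeSystem] at hlen
  have hn : m + k ≤ BitRAM.inputSize (encodeSystem B N b) := by nlinarith
  obtain ⟨s', t, hrun, -, ht, hans⟩ := BitRAM.does_solver (N := N) hm hB hdeep
    (BitRAM.ofInput_bounded _ (by unfold BitRAM.sizeBound; nlinarith))
  refine ⟨s'.output, ⟨s', t, hrun, ht.trans ?_, rfl⟩, hans⟩
  rw [hP]
  exact Nat.mul_le_mul_right _ (BitRAM.solverSteps_mono (by lia) (by lia) _)
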